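/- Let $1\le m\le n-2$ and $r=n-m-1$. Let $C^n$ be the $n$-dimensional conformal space, identified with the unit sphere $S^n\subset\mathbb R^{n+1}$. Equip $\mathbb R^{n+2}=\mathbb R^{n+1}\times\mathbb R$ with the form $((a,b),(a',b'))=\langle a,a'\rangle-bb'$. The Darboux mapping sends $s\in C^n$ to the point $[s:1]$ of the Darboux hyperquadric $Q^n=\{(X,X)=0\}\subset P^{n+1}$, and the hypersphere $\{s:\langle a,s\rangle=b\}$, where $|a|^2>b^2$, to the point $[a:b]$ outside $Q^n$. Let $V^{n-1}$ be a (smooth, immersed) $m$-canal hypersurface in $C^n$. That is, $V^{n-1}$ is the envelope of a smooth $r$-parameter family of hyperspheres, whose images under the Darboux mapping are the points $z(w)$, $w\in W$, $\dim W=r$, and form an immersed $r$-dimensional submanifold $U^r\subset P^{n+1}$: there is a smooth surjective submersion $\pi:V^{n-1}\to W$ such that at every point $p$ the hypersurface $V^{n-1}$ is tangent to the hypersphere with parameter $\pi(p)$. Let $\xi(w)$ be the polar hyperplane of $z(w)$ with respect to $Q^n$, and let $U^n\subset P^{n+1}$ be the envelope of the hyperplanes $\xi(w)$, that is, the union over $w\in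 W$ of their characteristics $\alpha(w)$, where $\alpha(w)$ consists of the points that satisfy the equation of $\xi(w)$ and its first derivatives with respect to the parameters. Theorem 5. (1) Each $\alpha(w)$ is a plane of dimension $m+1$, the polar, with respect to $Q^n$, of the tangent subspace of $U^r$ at $z(w)$. These planes depend smoothly on $w$, and $U^n$ is their union. (2) The planes $\alpha(w)$ sweep out a tangentially degenerate hypersurface of rank $r$. That is, in the parametrization $(w,t)\mapsto\big[\sum_i t_i a_i(w)\big]$ by any smooth local frame $a_0,\dots,a_{m+1}$ of the planes $\alpha(w)$, the regular points (those at which the tangent subspace of $U^n$ is a hyperplane of $P^{n+1}$) are dense, also in each single plane $\alpha(w)$, and at the regular points the Gauss map, which sends a point to the tangent hyperplane of $U^n$ there, is a smooth map of rank $r<n$ into the dual projective space. (3) At every regular point of $\alpha(w)$ the tangent hyperplane of $U^n$ is $\xi(w)$. Thus the $\xi(w)$ envelop $U^n$, whose tangent hyperplane is constant along each plane generator $\alpha(w)$. -/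

import Mathlib

open scoped Manifold ContDiff LinearAlgebra.Projectivization

noncomputable section

/-! ### Smooth maps into a real projective space

Smooth maps into `ℙ ℝ E` are handled through homogeneous coordinates, that is, through local smooth
lifts to `E` minus the origin. Planes of projective dimension `k` are linear subspaces of `E` of
dimension `k + 1`; a smooth map has rank `k` at a point if its projective tangent subspace there
has dimension `k`. -/

section Projective

variable {E : Type*} [NormedAddCommGroup E] [NormedSpace ℝ E]
  {B : Type*} [NormedAddCommGroup B] [NormedSpace ℝ B]
  {H : Type*} [TopologicalSpace H] (I : ModelWithCorners ℝ B H)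
  {M : Type*} [TopologicalSpace M] [ChartedSpace H M]

/-- The linear span of the vector `F p` and of all derivatives of `F` at `p`: the projective tangent
subspace at `p` of the map with homogeneous coordinates `F`. -/
def homogeneousTangent (F : M → E) (p : M) : Submodule ℝ E :=
  Submodule.span ℝ ({F p} ∪ Set.range (mvfderiv I F p))

/-- `Z` is a smooth choice of homogeneous coordinates for `z : M → ℙ ℝ E` on the open set `O`. -/
structure IsSmoothLiftOn (z : M → ℙ ℝ E) (O : Set M) (Z : M → E) : Prop where
  isOpen : IsOpen O
  smooth : ContMDiffOn I 𝓘(ℝ, E) ∞ Z O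
  lift : ∀ p ∈ O, ∃ h : Z p ≠ 0, Projectivization.mk ℝ (Z p) h = z p

/-- Smooth maps into the projective space. -/
def IsSmoothProjective (z : M → ℙ ℝ E) : Prop :=
  ∀ p, ∃ (O : Set M) (Z : M → E), p ∈ O ∧ IsSmoothLiftOn I z O Z

/-- The projective tangent subspace at `p` of a smooth map `z` into the projective space. All smooth
lifts of `z` near `p` yield the same subspace, so that the supremum is over equal subspaces. -/
def projectiveTangent (z : M → ℙ ℝ E) (p : M) : Submodule ℝ E :=
  ⨆ (O : Set M) (Z : M → E) (_ : IsSmoothLiftOn I z O Z) (_ : p ∈ O), homogeneousTangent I Z p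

/-! ### Families of hyperplanes and their envelopes -/

/-- `G` is a smooth choice of tangential coordinates, on the open set `O`, for the family `ξ` of
hyperplanes: the hyperplane `ξ p` has the equation `G p y = 0`. -/
structure IsSmoothEquationOn (ξ : M → Submodule ℝ E) (O : Set M) (G : M → (E →L[ℝ] ℝ)) : Prop where
  isOpen : IsOpen O
  smooth : ContMDiffOn I 𝓘(ℝ, E →L[ℝ] ℝ) ∞ G O
  ne_zero : ∀ p ∈ O, G p ≠ 0
  mem_iff : ∀ p ∈ O, ∀ y, y ∈ ξ p ↔ G p y = 0

/-- The characteristic at `p` of a smooth family `ξ` of hyperplanes: all `y` that satisfy the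
equation `G p y = 0` of the hyperplane `ξ p` together with its derivatives `dG p y = 0` with respect
to the parameters. All smooth equations `G` of the family near `p` yield the same subspace. -/
def characteristic (ξ : M → Submodule ℝ E) (p : M) : Submodule ℝ E :=
  ⨅ (O : Set M) (G : M → (E →L[ℝ] ℝ)) (_ : IsSmoothEquationOn I ξ O G) (_ : p ∈ O)
    (g : E →L[ℝ] ℝ) (_ : g ∈ homogeneousTangent I G p), LinearMap.ker (g : E →ₗ[ℝ] ℝ)

/-- The envelope of a smooth family of hyperplanes: the union of its characteristics. -/
def hyperplaneEnvelope (ξ : M → Submodule ℝ E) : Set (ℙ ℝ E) :=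
  {y | ∃ p, y.submodule ≤ characteristic I ξ p}

/-! ### Tangentially degenerate hypersurfaces -/

/-- `p` is a regular point of the hypersurface with homogeneous coordinates `F`: the tangent subspace
at `p` is a hyperplane. -/
def IsRegularHypersurfacePoint (F : M → E) (p : M) : Prop :=
  F p ≠ 0 ∧ Module.finrank ℝ (homogeneousTangent I F p) + 1 = Module.finrank ℝ E

/-- The Gauss map, which sends each point near `p` to its tangent hyperplane, is a smooth map of
rank `r` at `p` into the dual projective space. -/
def HasGaussRankAt (F : M → E) (p : M) (r : ℕ) : Prop :=
  ∃ (O : Set M) (G : M → (E →L[ℝ] ℝ)), p ∈ O ∧ IsSmoothEquationOn I (homogeneousTangent I F) O G ∧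
    Module.finrank ℝ (homogeneousTangent I G p) = r + 1

/-- The map with homogeneous coordinates `F`, defined on the open set `S`, parametrizes a tangentially
degenerate hypersurface of rank `r`: it is smooth, almost all of its points are regular, and at the
regular points the Gauss map has rank `r`, less than the dimension of the hypersurface (which is
`dim E - 2`). -/
structure IsTangentiallyDegenerateOn (F : M → E) (S : Set M) (r : ℕ) : Prop where
  isOpen : IsOpen S
  smooth : ContMDiffOn I 𝓘(ℝ, E) ∞ F S
  regular_dense : S ⊆ closure {p ∈ S | IsRegularHypersurfacePoint I F p}
  gauss_rank : ∀ p ∈ S, IsRegularHypersurfacePoint I F p → HasGaussRankAt I F p r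
  rank_lt : r + 2 < Module.finrank ℝ E

/-- On the open set `O`, the points `a p 0, …, a p (k - 1)` depend smoothly on `p` and form a basis
of the plane `α p`. -/
structure IsSmoothFrameOn (α : M → Submodule ℝ E) (O : Set M) {k : ℕ} (a : M → Fin k → E) :
    Prop where
  isOpen : IsOpen O
  smooth : ∀ i, ContMDiffOn I 𝓘(ℝ, E) ∞ (fun p => a p i) O
  linearIndependent : ∀ p ∈ O, LinearIndependent ℝ (a p)
  span : ∀ p ∈ O, Submodule.span ℝ (Set.range (a p)) = α p

/-- The variety swept out by the planes spanned by the points `a p i`, in homogeneous coordinates: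
the point `∑ tᵢ aᵢ(p)` of the plane with parameter `p`. -/
def sweep {k : ℕ} (a : M → Fin k → E) (q : M × (Fin k → ℝ)) : E :=
  ∑ i, q.2 i • a q.1 i

end Projective

/-! ### The conformal space, the Darboux hyperquadric and canal hypersurfaces -/

/-- The conformal space `Cⁿ`: the unit sphere of `ℝⁿ⁺¹`. -/
abbrev ConformalSpace (n : ℕ) : Type :=
  Metric.sphere (0 : EuclideanSpace ℝ (Fin (n + 1))) 1

/-- The vector space `ℝⁿ⁺²` of polyspherical coordinates; its projective space is `Pⁿ⁺¹`. -/
abbrev Polyspherical (n : ℕ) : Type := EuclideanSpace ℝ (Fin (n + 1)) × ℝ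

/-- The fundamental form, of signature `(n + 1, 1)`; its null points form the Darboux hyperquadric. -/
def darbouxForm (n : ℕ) : LinearMap.BilinForm ℝ (Polyspherical n) :=
  LinearMap.mk₂ ℝ (fun X Y => inner ℝ X.1 Y.1 - X.2 * Y.2)
    (fun X X' Y => by simp only [Prod.fst_add, Prod.snd_add, inner_add_left]; ring)
    (fun c X Y => by
      simp only [Prod.smul_fst, Prod.smul_snd, real_inner_smul_left, smul_eq_mul]; ring)
    (fun X Y Y' => by simp only [Prod.fst_add, Prod.snd_add, inner_add_right]; ring)
    (fun c X Y => by
      simp only [Prod.smul_fst, Prod.smul_snd, real_inner_smul_right, smul_eq_mul]; ring)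

/-- The polar subspace of a plane with respect to the Darboux hyperquadric. -/
def polar {n : ℕ} (T : Submodule ℝ (Polyspherical n)) : Submodule ℝ (Polyspherical n) :=
  (darbouxForm n).orthogonal T

/-- The Darboux mapping on points, in homogeneous coordinates: it maps `Cⁿ` bijectively onto the
Darboux hyperquadric. -/
def darbouxPoint {n : ℕ} (s : ConformalSpace n) : Polyspherical n := (s, 1)

/-- The points of `Pⁿ⁺¹` outside the Darboux hyperquadric, which are the images of the
hyperspheres of `Cⁿ` under the Darboux mapping. -/
def IsOutside {n : ℕ} (ζ : ℙ ℝ (Polyspherical n)) : Prop :=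
  0 < darbouxForm n ζ.rep ζ.rep

/-- The hypersphere of `Cⁿ` whose image under the Darboux mapping is `ζ = [a : b]`: all points `s` of
the conformal space with `⟪a, s⟫ = b`. -/
def hypersphere {n : ℕ} (ζ : ℙ ℝ (Polyspherical n)) : Set (ConformalSpace n) :=
  {s | darbouxPoint s ∈ polar ζ.submodule}

/-- The polar hyperplanes of the points `z w` with respect to the Darboux hyperquadric. -/
def polarFamily {n : ℕ} {W : Type*} (z : W → ℙ ℝ (Polyspherical n)) (w : W) :
    Submodule ℝ (Polyspherical n) :=
  polar (z w).submodule

/-- The map `x` into the conformal space touches the hypersphere with image `ζ` at the parameter `p`: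
the point `x p` lies on the hypersphere, and the differential of `x` at `p` takes its values in the
tangent space of the hypersphere. -/
def Touches {n : ℕ} (d : ℕ) {V : Type*} [TopologicalSpace V] [ChartedSpace (EuclideanSpace ℝ (Fin d)) V]
    (x : V → ConformalSpace n) (p : V) (ζ : ℙ ℝ (Polyspherical n)) : Prop :=
  x p ∈ hypersphere ζ ∧ ∀ v : TangentSpace (𝓡 d) p,
    mvfderiv (𝓡 d) (fun q => darbouxPoint (x q)) p v ∈ polar ζ.submodule

/-- The immersed hypersurface `x : V → Cⁿ` is an `m`-canal hypersurface: for `r = n - m - 1`, where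
`1 ≤ r` and `1 ≤ m`, it is the envelope of the `r`-parameter family of hyperspheres whose images under
the Darboux mapping are the points `z w`. The family depends smoothly and essentially on its `r`
parameters, `V` touches at `p` the hypersphere with parameter `π p`, each hypersphere of the family is
touched, and the contact hypersphere depends on exactly `r` parameters also as `p` varies in `V`. -/
structure IsCanalHypersurface (n m r : ℕ)
    {V : Type*} [TopologicalSpace V] [ChartedSpace (EuclideanSpace ℝ (Fin (n - 1))) V]
    {W : Type*} [TopologicalSpace W] [ChartedSpace (EuclideanSpace ℝ (Fin r)) W]
    (x : V → ConformalSpace n) (z : W → ℙ ℝ (Polyspherical n)) (π : V → W) : Prop where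
  one_le_m : 1 ≤ m
  one_le_r : 1 ≤ r
  dim : n = m + r + 1
  smooth : ContMDiff (𝓡 (n - 1)) (𝓡 n) ∞ x
  immersion : ∀ p, Function.Injective (mfderiv (𝓡 (n - 1)) (𝓡 n) x p)
  smooth_family : IsSmoothProjective (𝓡 r) z
  outside : ∀ w, IsOutside (z w)
  rank_family : ∀ w, Module.finrank ℝ (projectiveTangent (𝓡 r) z w) = r + 1
  smooth_param : ContMDiff (𝓡 (n - 1)) (𝓡 r) ∞ π
  submersion : ∀ p, Function.Surjective (mfderiv (𝓡 (n - 1)) (𝓡 r) π p)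
  surjective : Function.Surjective π
  touches : ∀ p, Touches (n - 1) x p (z (π p))

/-- The generator with parameter `w` of the envelope of the polar hyperplanes of the points `z w`: the
characteristic of this family of hyperplanes. -/
def generator {n : ℕ} (r : ℕ) {W : Type*} [TopologicalSpace W]
    [ChartedSpace (EuclideanSpace ℝ (Fin r)) W] (z : W → ℙ ℝ (Polyspherical n)) (w : W) :
    Submodule ℝ (Polyspherical n) :=
  characteristic (𝓡 r) (polarFamily z) w

end

/-! Write `( , )` for the fundamental form, `Z` for local homogeneous coordinates of the family, and
`T` for the span of `Z` and `dZ`. The hyperplane `ξ` has the equation `(Z, y) = 0`, so its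
characteristic is cut out by `(Z, y) = 0` and `(dZ v, y) = 0`. It is therefore the polar of `T`
(`characteristic_polarFamily`), and nondegeneracy of the form gives its dimension.

The sweep is governed by the symmetric form `H_y(v, v') = (y, d²Z(v, v'))`, linear in `y`. Let `X`
be a moving point of the generators. Differentiating `(Z, X) = 0` gives `(Z, dX) = 0`, so the
tangent subspace of the sweep lies in `ξ`. Differentiating `(dZ v', X) = 0` gives `(dZ v', dX v) =
-H_X(v, v')`, where on the right `v` stands for its parameter part. Hence the tangent subspace is
the generator enlarged by as many dimensions as the rank of `H_X`
(`finrank_homogeneousTangent_sweep`). A point is regular exactly when `H_X` is nondegenerate, and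
its tangent hyperplane is then `ξ`. The Gauss map thus factors through `w` as the point `Z(w)`
composed with the polarity, and has rank `r`.

For density, `det H` is a polynomial on each generator, so one point where it does not vanish
suffices. The canal hypersurface supplies it (`polarHessian_nondegenerate_of_contact`): the point of
contact `X` lies in the generator. If `u` is in the kernel of `H_X`, then `dZ u` is orthogonal to
`X` and to every `dX v`, and these vectors have the orthogonal complement `span {X, Z}`. So `dZ u =
c X + d Z`. If `c ≠ 0`, then `X ∈ T`, so all contact points with the same hypersphere are conjugate
to `X`. Conjugate points of the quadric coincide, so `x` would be constant on a fibre of `π` near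
the point. This is impossible for an immersion, since the fibres have dimension `m ≥ 1`. Hence `c =
0`, and the immersion of the family gives `u = 0`. -/

open Module Filter Topology

/-! ### Tangent subspaces and characteristics in homogeneous coordinates -/

section ManifoldCalculus

variable {E : Type*} [NormedAddCommGroup E] [NormedSpace ℝ E]
  {E' : Type*} [NormedAddCommGroup E'] [NormedSpace ℝ E']
  {B : Type*} [NormedAddCommGroup B] [NormedSpace ℝ B]
  {H : Type*} [TopologicalSpace H] {I : ModelWithCorners ℝ B H}
  {M : Type*} [TopologicalSpace M] [ChartedSpace H M]
  {B' : Type*} [NormedAddCommGroup B'] [NormedSpace ℝ B']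
  {H' : Type*} [TopologicalSpace H'] {J : ModelWithCorners ℝ B' H'}
  {N : Type*} [TopologicalSpace N] [ChartedSpace H' N]

theorem mem_homogeneousTangent_self (F : M → E) (p : M) : F p ∈ homogeneousTangent I F p :=
  Submodule.subset_span (Or.inl rfl)

theorem mvfderiv_mem_homogeneousTangent (F : M → E) (p : M) (v : TangentSpace I p) :
    mvfderiv I F p v ∈ homogeneousTangent I F p :=
  Submodule.subset_span (Or.inr ⟨v, rfl⟩)

theorem homogeneousTangent_le_iff {F : M → E} {p : M} {S : Submodule ℝ E} :
    homogeneousTangent I F p ≤ S ↔ F p ∈ S ∧ ∀ v, mvfderiv I F p v ∈ S := by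
  rw [homogeneousTangent, Submodule.span_le, Set.union_subset_iff, Set.singleton_subset_iff,
    Set.range_subset_iff]
  rfl

theorem mvfderiv_comp_vector {f : M → E} {g : N → M} {q : N}
    (hf : MDifferentiableAt I 𝓘(ℝ, E) f (g q)) (hg : MDifferentiableAt J I g q)
    (v : TangentSpace J q) :
    mvfderiv J (f ∘ g) q v = mvfderiv I f (g q) (mfderiv J I g q v) :=
  mfderiv_comp_apply q hf hg v

theorem mvfderiv_congr {f g : M → E} {p : M} (h : f =ᶠ[𝓝 p] g) (v : TangentSpace I p) :
    mvfderiv I f p v = mvfderiv I g p v := by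
  have := h.mfderiv_eq (I := I) (I' := 𝓘(ℝ, E))
  simp only [mvfderiv]
  exact congrArg (fun L : TangentSpace I p →L[ℝ] E => L v) this

theorem mvfderiv_clm_comp (L : E →L[ℝ] E') {f : M → E} {p : M}
    (hf : MDifferentiableAt I 𝓘(ℝ, E) f p) (v : TangentSpace I p) :
    mvfderiv I (fun q => L (f q)) p v = L (mvfderiv I f p v) := by
  have h := mvfderiv_comp_vector (f := L) (g := f) (q := p) (I := 𝓘(ℝ, E)) (J := I)
    (L.differentiableAt.mdifferentiableAt) hf v
  refine h.trans ?_
  show mfderiv 𝓘(ℝ, E) 𝓘(ℝ, E') L (f p) _ = _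
  rw [mfderiv_eq_fderiv, L.fderiv]
  rfl

theorem mvfderiv_eq_fderiv (f : B → E) (u : B) (v : B) :
    mvfderiv 𝓘(ℝ, B) f u v = fderiv ℝ f u v := by
  show mfderiv 𝓘(ℝ, B) 𝓘(ℝ, E) f u v = _
  rw [mfderiv_eq_fderiv]
  rfl

theorem fderiv_mem_homogeneousTangent (f : B → E) (u v : B) :
    fderiv ℝ f u v ∈ homogeneousTangent 𝓘(ℝ, B) f u := by
  rw [← mvfderiv_eq_fderiv]
  exact mvfderiv_mem_homogeneousTangent f u v

theorem homogeneousTangent_vectorSpace_le_iff {f : B → E} {u : B} {S : Submodule ℝ E} :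
    homogeneousTangent 𝓘(ℝ, B) f u ≤ S ↔ f u ∈ S ∧ ∀ v, fderiv ℝ f u v ∈ S := by
  simp only [← mvfderiv_eq_fderiv]
  exact homogeneousTangent_le_iff

theorem homogeneousTangent_congr {f g : M → E} {p : M} (h : f =ᶠ[𝓝 p] g) :
    homogeneousTangent I f p = homogeneousTangent I g p := by
  apply le_antisymm <;> refine homogeneousTangent_le_iff.2 ⟨?_, fun v => ?_⟩
  · rw [h.eq_of_nhds]; exact mem_homogeneousTangent_self g p
  · rw [mvfderiv_congr h]; exact mvfderiv_mem_homogeneousTangent g p v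
  · rw [← h.eq_of_nhds]; exact mem_homogeneousTangent_self f p
  · rw [← mvfderiv_congr h]; exact mvfderiv_mem_homogeneousTangent f p v

theorem homogeneousTangent_clm_comp (L : E →L[ℝ] E') {f : M → E} {p : M}
    (hf : MDifferentiableAt I 𝓘(ℝ, E) f p) :
    homogeneousTangent I (fun q => L (f q)) p =
      (homogeneousTangent I f p).map (L : E →ₗ[ℝ] E') := by
  rw [homogeneousTangent, homogeneousTangent, Submodule.map_span, Set.image_union,
    Set.image_singleton, ← Set.range_comp]
  congr 3
  ext1 v
  exact mvfderiv_clm_comp L hf v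

theorem homogeneousTangent_comp_le {f : M → E} {g : N → M} {q : N}
    (hf : MDifferentiableAt I 𝓘(ℝ, E) f (g q)) (hg : MDifferentiableAt J I g q) :
    homogeneousTangent J (f ∘ g) q ≤ homogeneousTangent I f (g q) := by
  refine homogeneousTangent_le_iff.2 ⟨mem_homogeneousTangent_self f (g q), fun v => ?_⟩
  rw [mvfderiv_comp_vector hf hg]
  exact mvfderiv_mem_homogeneousTangent _ _ _

theorem homogeneousTangent_comp_of_surjective {f : M → E} {g : N → M} {q : N}
    (hf : MDifferentiableAt I 𝓘(ℝ, E) f (g q)) (hg : MDifferentiableAt J I g q)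
    (hs : Function.Surjective (mfderiv J I g q)) :
    homogeneousTangent J (f ∘ g) q = homogeneousTangent I f (g q) := by
  refine (homogeneousTangent_comp_le hf hg).antisymm
    (homogeneousTangent_le_iff.2 ⟨mem_homogeneousTangent_self (f ∘ g) q, fun v => ?_⟩)
  obtain ⟨v, rfl⟩ := hs v
  rw [← mvfderiv_comp_vector hf hg]
  exact mvfderiv_mem_homogeneousTangent _ _ _

/-- The projective tangent subspace does not depend on the local coordinates. -/
theorem homogeneousTangent_eq_of_local_inverse {f : M → E} {g : N → M} {g' : M → N} {p : M}
    (hf : MDifferentiableAt I 𝓘(ℝ, E) f p) (hg : MDifferentiableAt J I g (g' p))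
    (hg' : MDifferentiableAt I J g' p) (h : ∀ᶠ q in 𝓝 p, g (g' q) = q) :
    homogeneousTangent I f p = homogeneousTangent J (f ∘ g) (g' p) := by
  have hp : g (g' p) = p := h.self_of_nhds
  have hf' : MDifferentiableAt I 𝓘(ℝ, E) f (g (g' p)) := by rwa [hp]
  apply le_antisymm
  · have h1 : f =ᶠ[𝓝 p] (f ∘ g) ∘ g' := by
      filter_upwards [h] with q hq
      simp [hq]
    rw [homogeneousTangent_congr h1]
    exact homogeneousTangent_comp_le (hf'.comp _ hg) hg'
  · have := homogeneousTangent_comp_le hf' hg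
    rwa [hp] at this

/-- Homogeneous coordinates that are proportional near a point span the same projective tangent
subspace there. -/
theorem homogeneousTangent_le_of_proportional {F F' : M → E} {p : M}
    (hF : MDifferentiableAt I 𝓘(ℝ, E) F p) (hF' : MDifferentiableAt I 𝓘(ℝ, E) F' p)
    (h0 : F p ≠ 0) (h : ∀ᶠ q in 𝓝 p, ∃ c : ℝ, F' q = c • F q) :
    homogeneousTangent I F' p ≤ homogeneousTangent I F p := by
  -- The factor `c` is not known to be differentiable. Pairing with `φ` replaces it by a quotient of
  -- differentiable functions, and cross-multiplication avoids the quotient.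
  obtain ⟨φ, -, hφ⟩ := exists_dual_vector ℝ (F p) (by simpa using h0)
  have hφ0 : φ (F p) ≠ 0 := by rw [hφ]; simpa using h0
  have hφF : MDifferentiableAt I 𝓘(ℝ, ℝ) (fun q => φ (F q)) p :=
    (φ.differentiableAt.mdifferentiableAt).comp p hF
  have hφF' : MDifferentiableAt I 𝓘(ℝ, ℝ) (fun q => φ (F' q)) p :=
    (φ.differentiableAt.mdifferentiableAt).comp p hF'
  have key : (fun q => φ (F q) • F' q) =ᶠ[𝓝 p] fun q => φ (F' q) • F q := by
    filter_upwards [h] with q ⟨c, hc⟩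
    rw [hc]
    simp [smul_smul, mul_comm]
  obtain ⟨c, hc⟩ := h.self_of_nhds
  have hF'p : F' p ∈ homogeneousTangent I F p := by
    rw [hc]
    exact Submodule.smul_mem _ _ (mem_homogeneousTangent_self F p)
  refine homogeneousTangent_le_iff.2 ⟨hF'p, fun v => ?_⟩
  have hd := mvfderiv_congr (I := I) key v
  rw [mvfderiv_fun_smul hφF hF', mvfderiv_fun_smul hφF' hF] at hd
  simp only [add_apply, smul_apply,
    ContinuousLinearMap.smulRight_apply] at hd
  have h2 : φ (F p) • mvfderiv I F' p v ∈ homogeneousTangent I F p := by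
    rw [eq_sub_of_add_eq hd]
    refine Submodule.sub_mem _ (Submodule.add_mem _ (Submodule.smul_mem _ _ ?_)
      (Submodule.smul_mem _ _ ?_)) (Submodule.smul_mem _ _ hF'p)
    · exact mvfderiv_mem_homogeneousTangent F p v
    · exact mem_homogeneousTangent_self F p
  exact (Submodule.smul_mem_iff _ hφ0).1 h2

theorem IsSmoothLiftOn.mdifferentiableAt {z : M → ℙ ℝ E} {O : Set M} {Z : M → E}
    (h : IsSmoothLiftOn I z O Z) {p : M} (hp : p ∈ O) : MDifferentiableAt I 𝓘(ℝ, E) Z p :=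
  (h.smooth.contMDiffAt (h.isOpen.mem_nhds hp)).mdifferentiableAt (by simp)

theorem IsSmoothLiftOn.ne_zero {z : M → ℙ ℝ E} {O : Set M} {Z : M → E}
    (h : IsSmoothLiftOn I z O Z) {p : M} (hp : p ∈ O) : Z p ≠ 0 :=
  (h.lift p hp).1

theorem IsSmoothLiftOn.submodule_eq {z : M → ℙ ℝ E} {O : Set M} {Z : M → E}
    (h : IsSmoothLiftOn I z O Z) {p : M} (hp : p ∈ O) :
    (z p).submodule = Submodule.span ℝ {Z p} := by
  obtain ⟨h0, hz⟩ := h.lift p hp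
  rw [← hz, Projectivization.submodule_mk]

theorem projectiveTangent_eq_homogeneousTangent {z : M → ℙ ℝ E} {O : Set M} {Z : M → E}
    (h : IsSmoothLiftOn I z O Z) {p : M} (hp : p ∈ O) :
    projectiveTangent I z p = homogeneousTangent I Z p := by
  apply le_antisymm
  · refine iSup_le fun O' => iSup_le fun Z' => iSup_le fun h' => iSup_le fun hp' => ?_
    refine homogeneousTangent_le_of_proportional (h.mdifferentiableAt hp) (h'.mdifferentiableAt hp')
      (h.ne_zero hp) ?_
    filter_upwards [h.isOpen.mem_nhds hp, h'.isOpen.mem_nhds hp'] with q hq hq'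
    have := (h.submodule_eq hq).symm.trans (h'.submodule_eq hq')
    have hm : Z' q ∈ Submodule.span ℝ {Z q} := this ▸ Submodule.mem_span_singleton_self _
    obtain ⟨c, hc⟩ := Submodule.mem_span_singleton.1 hm
    exact ⟨c, hc.symm⟩
  · exact le_iSup_of_le O (le_iSup_of_le Z (le_iSup_of_le h (le_iSup_of_le hp le_rfl)))

theorem IsSmoothEquationOn.mdifferentiableAt {ξ : M → Submodule ℝ E} {O : Set M}
    {G : M → (E →L[ℝ] ℝ)} (h : IsSmoothEquationOn I ξ O G) {p : M} (hp : p ∈ O) :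
    MDifferentiableAt I 𝓘(ℝ, E →L[ℝ] ℝ) G p :=
  (h.smooth.contMDiffAt (h.isOpen.mem_nhds hp)).mdifferentiableAt (by simp)

/-- Two equations of the same hyperplanes are proportional at each point, so they span the same
tangent subspace. A single equation therefore decides membership. -/
theorem mem_characteristic_iff {ξ : M → Submodule ℝ E} {O : Set M}
    {G : M → (E →L[ℝ] ℝ)} (h : IsSmoothEquationOn I ξ O G) {p : M} (hp : p ∈ O) {y : E} :
    y ∈ characteristic I ξ p ↔ ∀ g ∈ homogeneousTangent I G p, g y = 0 := by
  simp only [characteristic, Submodule.mem_iInf, LinearMap.mem_ker, ContinuousLinearMap.coe_coe]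
  refine ⟨fun H => H O G h hp, fun H O' G' h' hp' g hg => H g ?_⟩
  refine homogeneousTangent_le_of_proportional (h.mdifferentiableAt hp) (h'.mdifferentiableAt hp')
    (h.ne_zero p hp) ?_ hg
  filter_upwards [h.isOpen.mem_nhds hp, h'.isOpen.mem_nhds hp'] with q hq hq'
  have hker : LinearMap.ker (G q : E →ₗ[ℝ] ℝ) ≤ LinearMap.ker (G' q : E →ₗ[ℝ] ℝ) := fun y hy =>
    (h'.mem_iff q hq' y).1 ((h.mem_iff q hq y).2 hy)
  have hs : (G' q : E →ₗ[ℝ] ℝ) ∈ Submodule.span ℝ (Set.range ![(G q : E →ₗ[ℝ] ℝ)]) :=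
    (mem_span_of_iInf_ker_le_ker (L := ![(G q : E →ₗ[ℝ] ℝ)]) (by simpa using hker))
  simp only [Matrix.range_cons, Matrix.range_empty, Set.union_empty] at hs
  obtain ⟨c, hc⟩ := Submodule.mem_span_singleton.1 hs
  refine ⟨c, ContinuousLinearMap.ext fun y => ?_⟩
  exact (congrArg (fun l : E →ₗ[ℝ] ℝ => l y) hc).symm

end ManifoldCalculus

/-! ### The Darboux form and polarity -/

section DarbouxForm

variable {n : ℕ}

theorem darbouxForm_apply (X Y : Polyspherical n) :
    darbouxForm n X Y = inner ℝ X.1 Y.1 - X.2 * Y.2 := rfl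

theorem darbouxForm_comm (X Y : Polyspherical n) :
    darbouxForm n X Y = darbouxForm n Y X := by
  rw [darbouxForm_apply, darbouxForm_apply, real_inner_comm, mul_comm]

theorem darbouxForm_nondegenerate : (darbouxForm n).Nondegenerate := by
  have key : ∀ X, (∀ Y, darbouxForm n X Y = 0) → X = 0 := fun X hX => by
    -- Flipping the sign of the last coordinate turns the pairing into the sum of squares `‖X.1‖² +
    -- X.2²`.
    have h1 := hX (X.1, -X.2)
    rw [darbouxForm_apply] at h1
    simp only [real_inner_self_eq_norm_sq] at h1
    have h2 : ‖X.1‖ = 0 := by nlinarith [sq_nonneg ‖X.1‖, sq_nonneg X.2]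
    have h3 : X.2 = 0 := by nlinarith [sq_nonneg ‖X.1‖, sq_nonneg X.2]
    exact Prod.ext (norm_eq_zero.1 h2) h3
  exact ⟨key, fun X hX => key X fun Y => by rw [darbouxForm_comm]; exact hX Y⟩

theorem finrank_polyspherical : finrank ℝ (Polyspherical n) = n + 2 := by
  rw [Module.finrank_prod, finrank_euclideanSpace_fin, Module.finrank_self]

theorem finrank_polar (T : Submodule ℝ (Polyspherical n)) :
    finrank ℝ (polar T) = n + 2 - finrank ℝ T := by
  rw [polar, LinearMap.BilinForm.finrank_orthogonal darbouxForm_nondegenerate,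
    finrank_polyspherical]

theorem mem_polar {T : Submodule ℝ (Polyspherical n)} {y : Polyspherical n} :
    y ∈ polar T ↔ ∀ x ∈ T, darbouxForm n x y = 0 :=
  LinearMap.BilinForm.mem_orthogonal_iff

theorem mem_polar_span {s : Set (Polyspherical n)} {y : Polyspherical n} :
    y ∈ polar (Submodule.span ℝ s) ↔ ∀ x ∈ s, darbouxForm n x y = 0 := by
  rw [mem_polar]
  refine ⟨fun h x hx => h x (Submodule.subset_span hx), fun h x hx => ?_⟩
  induction hx using Submodule.span_induction with
  | mem x hx => exact h x hx
  | zero => simp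
  | add x x' _ _ hx hx' => rw [map_add, LinearMap.add_apply, hx, hx', add_zero]
  | smul c x _ hx => rw [map_smul, LinearMap.smul_apply, hx, smul_zero]

theorem mem_polar_span_singleton {x y : Polyspherical n} :
    y ∈ polar (Submodule.span ℝ {x}) ↔ darbouxForm n x y = 0 := by
  simp [mem_polar_span]

variable (n) in
/-- The fundamental form as a continuous bilinear map. -/
noncomputable def darbouxCLM : Polyspherical n →L[ℝ] Polyspherical n →L[ℝ] ℝ :=
  (innerSL ℝ).bilinearComp (ContinuousLinearMap.fst ℝ _ _) (ContinuousLinearMap.fst ℝ _ _) -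
    (ContinuousLinearMap.mul ℝ ℝ).bilinearComp (ContinuousLinearMap.snd ℝ _ _)
      (ContinuousLinearMap.snd ℝ _ _)

@[simp]
theorem darbouxCLM_apply (X Y : Polyspherical n) : darbouxCLM n X Y = darbouxForm n X Y := rfl

theorem darbouxCLM_injective : Function.Injective (darbouxCLM n) := by
  refine (injective_iff_map_eq_zero _).2 fun X hX => ?_
  exact darbouxForm_nondegenerate.1 X fun Y => by rw [← darbouxCLM_apply, hX]; rfl

/-- This is the equality case of Cauchy–Schwarz for unit vectors: the quadric contains no lines, so
distinct points of it are never conjugate. -/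
theorem darbouxForm_darbouxPoint (s t : ConformalSpace n) :
    darbouxForm n (darbouxPoint s) (darbouxPoint t) = 0 ↔ s = t := by
  have hs : ‖(s : EuclideanSpace ℝ (Fin (n + 1)))‖ = 1 := norm_eq_of_mem_sphere s
  have ht : ‖(t : EuclideanSpace ℝ (Fin (n + 1)))‖ = 1 := norm_eq_of_mem_sphere t
  rw [darbouxForm_apply, darbouxPoint, darbouxPoint, mul_one, sub_eq_zero,
    inner_eq_one_iff_of_norm_eq_one hs ht, Subtype.ext_iff]

end DarbouxForm

/-! ### Characteristics of the polar hyperplanes -/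

section PolarFamily

variable {n : ℕ} {B : Type*} [NormedAddCommGroup B] [NormedSpace ℝ B]
  {H : Type*} [TopologicalSpace H] {I : ModelWithCorners ℝ B H}
  {M : Type*} [TopologicalSpace M] [ChartedSpace H M]

theorem IsSmoothLiftOn.mem_polarFamily {z : M → ℙ ℝ (Polyspherical n)} {O : Set M}
    {Z : M → Polyspherical n} (h : IsSmoothLiftOn I z O Z) {p : M} (hp : p ∈ O)
    {y : Polyspherical n} : y ∈ polarFamily z p ↔ darbouxForm n (Z p) y = 0 := by
  rw [polarFamily, h.submodule_eq hp, mem_polar_span_singleton]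

theorem IsSmoothLiftOn.isSmoothEquationOn_polarFamily {z : M → ℙ ℝ (Polyspherical n)} {O : Set M}
    {Z : M → Polyspherical n} (h : IsSmoothLiftOn I z O Z) :
    IsSmoothEquationOn I (polarFamily z) O (fun p => darbouxCLM n (Z p)) where
  isOpen := h.isOpen
  smooth := (darbouxCLM n).contDiff.contMDiff.comp_contMDiffOn h.smooth
  ne_zero p hp h0 := h.ne_zero hp (darbouxCLM_injective (by rw [h0, map_zero]))
  mem_iff p hp y := h.mem_polarFamily hp

/-- The characteristics of the polar hyperplanes of a family of points are the polars of the tangent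
subspaces of the family. -/
theorem characteristic_polarFamily {z : M → ℙ ℝ (Polyspherical n)} (hz : IsSmoothProjective I z)
    (p : M) : characteristic I (polarFamily z) p = polar (projectiveTangent I z p) := by
  obtain ⟨O, Z, hp, h⟩ := hz p
  ext y
  rw [mem_characteristic_iff h.isSmoothEquationOn_polarFamily hp,
    homogeneousTangent_clm_comp _ (h.mdifferentiableAt hp),
    projectiveTangent_eq_homogeneousTangent h hp, mem_polar]
  simp only [Submodule.mem_map, forall_exists_index, and_imp, forall_apply_eq_imp_iff₂]
  rfl

end PolarFamily

/-! ### Passage to charts of the parameter manifold -/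

section Coordinates

variable {r : ℕ} {W : Type*} [TopologicalSpace W] [ChartedSpace (EuclideanSpace ℝ (Fin r)) W]

theorem isOpen_extChartAt_target_inter (w : W) {O : Set W} (hO : IsOpen O) :
    IsOpen ((extChartAt (𝓡 r) w).target ∩ (extChartAt (𝓡 r) w).symm ⁻¹' O) :=
  (continuousOn_extChartAt_symm w).isOpen_inter_preimage (isOpen_extChartAt_target w) hO

theorem extChartAt_mem_target_inter (w : W) {O : Set W} {w' : W} (hw' : w' ∈ O)
    (hs : w' ∈ (extChartAt (𝓡 r) w).source) : extChartAt (𝓡 r) w w' ∈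
      (extChartAt (𝓡 r) w).target ∩ (extChartAt (𝓡 r) w).symm ⁻¹' O :=
  ⟨(extChartAt (𝓡 r) w).map_source hs, by
    rwa [Set.mem_preimage, (extChartAt (𝓡 r) w).left_inv hs]⟩

variable [IsManifold (𝓡 r) ∞ W]

theorem contMDiffOn_extChartAt_symm_comp {F : Type*} [NormedAddCommGroup F] [NormedSpace ℝ F]
    {f : W → F} {O : Set W} (hf : ContMDiffOn (𝓡 r) 𝓘(ℝ, F) ∞ f O) (w : W) :
    ContDiffOn ℝ ∞ (f ∘ (extChartAt (𝓡 r) w).symm)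
      ((extChartAt (𝓡 r) w).target ∩ (extChartAt (𝓡 r) w).symm ⁻¹' O) :=
  contMDiffOn_iff_contDiffOn.1 <| hf.comp
    ((contMDiffOn_extChartAt_symm w).mono Set.inter_subset_left) Set.inter_subset_right

theorem contDiffAt_comp_extChartAt_symm {F : Type*} [NormedAddCommGroup F] [NormedSpace ℝ F]
    {f : W → F} {O : Set W} (hO : IsOpen O) (hf : ContMDiffOn (𝓡 r) 𝓘(ℝ, F) ∞ f O) (w : W)
    {u : EuclideanSpace ℝ (Fin r)}
    (hu : u ∈ (extChartAt (𝓡 r) w).target ∩ (extChartAt (𝓡 r) w).symm ⁻¹' O) :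
    ContDiffAt ℝ ∞ (f ∘ (extChartAt (𝓡 r) w).symm) u :=
  (contMDiffOn_extChartAt_symm_comp hf w).contDiffAt
    ((isOpen_extChartAt_target_inter w hO).mem_nhds hu)

theorem mdifferentiableAt_extChartAt_symm (w : W) {u : EuclideanSpace ℝ (Fin r)}
    (hu : u ∈ (extChartAt (𝓡 r) w).target) :
    MDifferentiableAt 𝓘(ℝ, EuclideanSpace ℝ (Fin r)) (𝓡 r) (extChartAt (𝓡 r) w).symm u :=
  ((contMDiffOn_extChartAt_symm (n := ∞) w).contMDiffAt
    ((isOpen_extChartAt_target w).mem_nhds hu)).mdifferentiableAt (by simp)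

theorem homogeneousTangent_extChartAt_symm {F : Type*} [NormedAddCommGroup F] [NormedSpace ℝ F]
    {f : W → F} (w : W) {u : EuclideanSpace ℝ (Fin r)} (hu : u ∈ (extChartAt (𝓡 r) w).target)
    (hf : MDifferentiableAt (𝓡 r) 𝓘(ℝ, F) f ((extChartAt (𝓡 r) w).symm u)) :
    homogeneousTangent (𝓡 r) f ((extChartAt (𝓡 r) w).symm u) =
      homogeneousTangent 𝓘(ℝ, EuclideanSpace ℝ (Fin r)) (f ∘ (extChartAt (𝓡 r) w).symm) u := by
  have h1 : extChartAt (𝓡 r) w ((extChartAt (𝓡 r) w).symm u) = u :=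
    (extChartAt (𝓡 r) w).right_inv hu
  have hs := (extChartAt (𝓡 r) w).map_target hu
  have := homogeneousTangent_eq_of_local_inverse (g := (extChartAt (𝓡 r) w).symm)
    (g' := extChartAt (𝓡 r) w) (J := 𝓘(ℝ, EuclideanSpace ℝ (Fin r))) hf
    (by rw [h1]; exact mdifferentiableAt_extChartAt_symm w hu)
    ((contMDiffAt_extChartAt' (n := ∞)
      (by rwa [extChartAt_source] at hs)).mdifferentiableAt (by simp)) (by
      filter_upwards [(isOpen_extChartAt_source w).mem_nhds hs] with q hq
      exact (extChartAt (𝓡 r) w).left_inv hq)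
  rwa [h1] at this

theorem homogeneousTangent_prod_extChartAt_symm {F : Type*} [NormedAddCommGroup F]
    [NormedSpace ℝ F] {k : ℕ} {f : W × (Fin k → ℝ) → F} (w : W) {u : EuclideanSpace ℝ (Fin r)}
    (hu : u ∈ (extChartAt (𝓡 r) w).target) (t : Fin k → ℝ)
    (hf : MDifferentiableAt ((𝓡 r).prod 𝓘(ℝ, Fin k → ℝ)) 𝓘(ℝ, F) f
      ((extChartAt (𝓡 r) w).symm u, t)) :
    homogeneousTangent ((𝓡 r).prod 𝓘(ℝ, Fin k → ℝ)) f ((extChartAt (𝓡 r) w).symm u, t) =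
      homogeneousTangent 𝓘(ℝ, EuclideanSpace ℝ (Fin r) × (Fin k → ℝ))
        (fun q => f ((extChartAt (𝓡 r) w).symm q.1, q.2)) (u, t) := by
  have h1 : extChartAt (𝓡 r) w ((extChartAt (𝓡 r) w).symm u) = u :=
    (extChartAt (𝓡 r) w).right_inv hu
  have hs := (extChartAt (𝓡 r) w).map_target hu
  have := homogeneousTangent_eq_of_local_inverse
    (g := fun q : EuclideanSpace ℝ (Fin r) × (Fin k → ℝ) => ((extChartAt (𝓡 r) w).symm q.1, q.2))
    (g' := fun q => (extChartAt (𝓡 r) w q.1, q.2))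
    (J := 𝓘(ℝ, EuclideanSpace ℝ (Fin r) × (Fin k → ℝ))) hf
    (by
      simp only [h1]
      refine MDifferentiableAt.prodMk ?_ ?_
      · exact MDifferentiableAt.comp (I' := 𝓘(ℝ, EuclideanSpace ℝ (Fin r))) (u, t)
          (g := (extChartAt (𝓡 r) w).symm) (f := Prod.fst)
          (mdifferentiableAt_extChartAt_symm w hu) differentiableAt_fst.mdifferentiableAt
      · exact differentiableAt_snd.mdifferentiableAt)
    (by
      -- The product vector space must be seen as a product manifold before the components can be
      -- treated separately.
      rw [modelWithCornersSelf_prod, ← chartedSpaceSelf_prod]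
      refine MDifferentiableAt.prodMk ?_ mdifferentiableAt_snd
      exact MDifferentiableAt.comp (I' := 𝓡 r) _ (g := extChartAt (𝓡 r) w) (f := Prod.fst)
        ((contMDiffAt_extChartAt' (n := ∞)
          (by rwa [extChartAt_source] at hs)).mdifferentiableAt (by simp)) mdifferentiableAt_fst)
    (by
      have : ∀ᶠ q : W in 𝓝 ((extChartAt (𝓡 r) w).symm u),
          (extChartAt (𝓡 r) w).symm (extChartAt (𝓡 r) w q) = q := by
        filter_upwards [(isOpen_extChartAt_source w).mem_nhds hs] with q hq
        exact (extChartAt (𝓡 r) w).left_inv hq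
      filter_upwards [continuousAt_fst.eventually this] with q hq
      exact Prod.ext hq rfl)
  simp only [h1] at this
  exact this

end Coordinates

/-! ### The Hessian form and first-order variation of points in the generators -/

section PolarHessian

variable {n : ℕ} {P : Type*} [NormedAddCommGroup P] [NormedSpace ℝ P]
  {Q : Type*} [NormedAddCommGroup Q] [NormedSpace ℝ Q]

theorem mem_polar_homogeneousTangent {Z : P → Polyspherical n} {u : P} {y : Polyspherical n} :
    y ∈ polar (homogeneousTangent 𝓘(ℝ, P) Z u) ↔
      darbouxForm n (Z u) y = 0 ∧ ∀ v, darbouxForm n (fderiv ℝ Z u v) y = 0 := by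
  constructor
  · exact fun h => ⟨mem_polar.1 h _ (mem_homogeneousTangent_self Z u), fun v =>
      mem_polar.1 h _ (fderiv_mem_homogeneousTangent Z u v)⟩
  · rintro ⟨h1, h2⟩
    refine mem_polar.2 (homogeneousTangent_vectorSpace_le_iff
      (S := LinearMap.ker ((darbouxForm n).flip y)).2 ⟨h1, h2⟩)

/-- The second derivative of the homogeneous coordinates `Z`, paired with `y`. -/
noncomputable def polarHessian (Z : P → Polyspherical n) (u : P) (y : Polyspherical n) :
    LinearMap.BilinForm ℝ P :=
  LinearMap.mk₂ ℝ (fun v v' => darbouxForm n y (fderiv ℝ (fderiv ℝ Z) u v v'))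
    (fun v w v' => by simp) (fun c v v' => by simp) (fun v v' w => by simp)
    (fun c v v' => by simp)

@[simp]
theorem polarHessian_apply (Z : P → Polyspherical n) (u : P) (y : Polyspherical n) (v v' : P) :
    polarHessian Z u y v v' = darbouxForm n y (fderiv ℝ (fderiv ℝ Z) u v v') := rfl

theorem darbouxForm_hasFDerivAt {X Y : Q → Polyspherical n} {q : Q}
    {X' Y' : Q →L[ℝ] Polyspherical n} (hX : HasFDerivAt X X' q) (hY : HasFDerivAt Y Y' q)
    (h : ∀ᶠ q in 𝓝 q, darbouxForm n (X q) (Y q) = 0) (v : Q) :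
    darbouxForm n (X q) (Y' v) + darbouxForm n (X' v) (Y q) = 0 := by
  have h1 := (darbouxCLM n).hasFDerivAt_of_bilinear hX hY
  have h2 : HasFDerivAt (fun q => darbouxCLM n (X q) (Y q)) (0 : Q →L[ℝ] ℝ) q :=
    (hasFDerivAt_const (0 : ℝ) q).congr_of_eventuallyEq h
  exact congrArg (fun L : Q →L[ℝ] ℝ => L v) (h1.unique h2)

variable {Z : P → Polyspherical n} {h : Q → P} {X : Q → Polyspherical n} {q : Q}

/-- A moving point of the characteristics stays, to first order, in the polar hyperplane. -/
theorem darbouxForm_fderiv_eq_zero (hZ : ContDiffAt ℝ ∞ Z (h q)) (hh : DifferentiableAt ℝ h q)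
    (hX : DifferentiableAt ℝ X q)
    (hp : ∀ᶠ q in 𝓝 q, X q ∈ polar (homogeneousTangent 𝓘(ℝ, P) Z (h q))) (v : Q) :
    darbouxForm n (Z (h q)) (fderiv ℝ X q v) = 0 := by
  have hZ' := (hZ.differentiableAt (by simp)).hasFDerivAt.comp q hh.hasFDerivAt
  have := darbouxForm_hasFDerivAt hZ' hX.hasFDerivAt
    (hp.mono fun q hq => (mem_polar_homogeneousTangent.1 hq).1) v
  have h2 := (mem_polar_homogeneousTangent.1 hp.self_of_nhds).2 (fderiv ℝ h q v)
  simpa [h2] using this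

/-- Differentiating `(dZ v', X) = 0` leaves two terms, and the one containing `d²Z` is the Hessian
form at `X`. This identity converts tangent vectors of the sweep into values of the Hessian. -/
theorem darbouxForm_fderiv_fderiv (hZ : ContDiffAt ℝ ∞ Z (h q)) (hh : DifferentiableAt ℝ h q)
    (hX : DifferentiableAt ℝ X q)
    (hp : ∀ᶠ q in 𝓝 q, X q ∈ polar (homogeneousTangent 𝓘(ℝ, P) Z (h q))) (v : Q) (v' : P) :
    darbouxForm n (fderiv ℝ Z (h q) v') (fderiv ℝ X q v) =
      - polarHessian Z (h q) (X q) (fderiv ℝ h q v) v' := by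
  have hZ1 : DifferentiableAt ℝ (fderiv ℝ Z) (h q) :=
    (hZ.fderiv_right (m := ∞) le_rfl).differentiableAt (by simp)
  have hZ' := (hZ1.hasFDerivAt.comp q hh.hasFDerivAt).clm_apply (hasFDerivAt_const v' q)
  have := darbouxForm_hasFDerivAt hZ' hX.hasFDerivAt
    (hp.mono fun q hq => (mem_polar_homogeneousTangent.1 hq).2 v') v
  rw [polarHessian_apply, darbouxForm_comm (X q)]
  simp at this
  linarith

end PolarHessian

/-! ### Tangent subspaces of the swept hypersurface -/

section Sweep

theorem sweep_mem {M E : Type*} [NormedAddCommGroup E] [NormedSpace ℝ E] {k : ℕ}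
    {a : M → Fin k → E} {α : Submodule ℝ E} {p : M}
    (h : ∀ i, a p i ∈ α) (t : Fin k → ℝ) : sweep a (p, t) ∈ α :=
  Submodule.sum_mem _ fun i _ => Submodule.smul_mem _ _ (h i)

variable {n k : ℕ} {P : Type*} [NormedAddCommGroup P] [NormedSpace ℝ P]
  {Z : P → Polyspherical n} {a : P → Fin k → Polyspherical n} {u : P}

theorem differentiableAt_sweep (ha : ∀ i, DifferentiableAt ℝ (fun p => a p i) u) (t : Fin k → ℝ) :
    DifferentiableAt ℝ (sweep a) (u, t) := by
  have h1 : ∀ i, DifferentiableAt ℝ (fun q : P × (Fin k → ℝ) => a q.1 i) (u, t) := fun i =>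
    DifferentiableAt.comp (g := fun p => a p i) (u, t) (ha i) differentiableAt_fst
  unfold sweep
  fun_prop

/-- For fixed `u` the sweep is linear in `t`, so it is its own derivative in these directions. -/
theorem fderiv_sweep_snd (ha : ∀ i, DifferentiableAt ℝ (fun p => a p i) u) (t s : Fin k → ℝ) :
    fderiv ℝ (sweep a) (u, t) (0, s) = sweep a (u, s) := by
  have h1 := (differentiableAt_sweep ha t).hasFDerivAt.comp t
    ((hasFDerivAt_const u t).prodMk (hasFDerivAt_id t))
  let L : (Fin k → ℝ) →L[ℝ] Polyspherical n :=
    ∑ i, (ContinuousLinearMap.proj (R := ℝ) (φ := fun _ : Fin k => ℝ) i).smulRight (a u i)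
  have h2 : HasFDerivAt (sweep a ∘ fun t => (u, t)) L t := by
    convert L.hasFDerivAt using 1
    ext1 t
    simp [sweep, L]
  have := congrArg (fun l : (Fin k → ℝ) →L[ℝ] Polyspherical n => l s) (h1.unique h2)
  simpa [sweep, L] using this

theorem eventually_sweep_mem_polar
    (hs : ∀ᶠ p in 𝓝 u, Submodule.span ℝ (Set.range (a p)) =
      polar (homogeneousTangent 𝓘(ℝ, P) Z p)) (t : Fin k → ℝ) :
    ∀ᶠ q : P × (Fin k → ℝ) in 𝓝 (u, t),
    sweep a q ∈ polar (homogeneousTangent 𝓘(ℝ, P) Z q.1) := by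
  filter_upwards [continuousAt_fst.eventually hs] with q hq
  exact sweep_mem (fun i => hq ▸ Submodule.subset_span ⟨i, rfl⟩) q.2

variable (hZ : ContDiffAt ℝ ∞ Z u)
  (ha : ∀ i, DifferentiableAt ℝ (fun p => a p i) u)
  (hs : ∀ᶠ p in 𝓝 u, Submodule.span ℝ (Set.range (a p)) =
    polar (homogeneousTangent 𝓘(ℝ, P) Z p))
include hZ ha hs

theorem homogeneousTangent_sweep_le (t : Fin k → ℝ) :
    homogeneousTangent 𝓘(ℝ, P × (Fin k → ℝ)) (sweep a) (u, t) ≤ polar (Submodule.span ℝ {Z u}) := by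
  have hmem := eventually_sweep_mem_polar hs t
  refine homogeneousTangent_vectorSpace_le_iff.2 ⟨?_, fun v => ?_⟩
  · exact mem_polar_span_singleton.2 (mem_polar_homogeneousTangent.1 hmem.self_of_nhds).1
  · exact mem_polar_span_singleton.2 (darbouxForm_fderiv_eq_zero (h := Prod.fst) (q := (u, t)) hZ
      differentiableAt_fst (differentiableAt_sweep ha t) hmem v)

/-- Rank–nullity for `y ↦ (dZ ·, y)` on the tangent subspace: the image is the range of the Hessian
form, and the kernel is the generator. -/
theorem finrank_homogeneousTangent_sweep (t : Fin k → ℝ) :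
    finrank ℝ (homogeneousTangent 𝓘(ℝ, P × (Fin k → ℝ)) (sweep a) (u, t)) =
      finrank ℝ (LinearMap.range (polarHessian Z u (sweep a (u, t)))) +
        finrank ℝ (polar (homogeneousTangent 𝓘(ℝ, P) Z u)) := by
  set N := homogeneousTangent 𝓘(ℝ, P × (Fin k → ℝ)) (sweep a) (u, t) with hN
  have hmem := eventually_sweep_mem_polar hs t
  let Ψ : Polyspherical n →ₗ[ℝ] Module.Dual ℝ P :=
    (darbouxForm n).flip.compl₂ (fderiv ℝ Z u : P →ₗ[ℝ] _)
  have hΨ : ∀ y v, Ψ y v = darbouxForm n (fderiv ℝ Z u v) y := fun y v => rfl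
  have hder : ∀ v : P × (Fin k → ℝ), Ψ (fderiv ℝ (sweep a) (u, t) v) =
      - polarHessian Z u (sweep a (u, t)) v.1 := fun v => by
    ext v'
    rw [hΨ]
    have := darbouxForm_fderiv_fderiv (h := Prod.fst) (q := (u, t)) hZ
      differentiableAt_fst (differentiableAt_sweep ha t) hmem v v'
    rw [this, fderiv_fst]
    rfl
  have hmap : N.map Ψ = LinearMap.range (polarHessian Z u (sweep a (u, t))) := by
    apply le_antisymm
    · rw [Submodule.map_le_iff_le_comap, hN]
      refine homogeneousTangent_vectorSpace_le_iff.2 ⟨?_, fun v => ?_⟩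
      · have : Ψ (sweep a (u, t)) = 0 := by
          ext v
          exact (mem_polar_homogeneousTangent.1 hmem.self_of_nhds).2 v
        rw [Submodule.mem_comap, this]
        exact Submodule.zero_mem _
      · rw [Submodule.mem_comap, hder]
        exact Submodule.neg_mem _ ⟨_, rfl⟩
    · rintro _ ⟨v, rfl⟩
      -- The sign compensates the minus in `hder`. The `t`-directions contribute nothing to the
      -- image.
      refine ⟨fderiv ℝ (sweep a) (u, t) (-v, 0), ?_, ?_⟩
      · exact fderiv_mem_homogeneousTangent _ _ _
      · rw [hder]
        simp
  have hle : polar (homogeneousTangent 𝓘(ℝ, P) Z u) ≤ N := by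
    rw [← hs.self_of_nhds, Submodule.span_le]
    rintro _ ⟨i, rfl⟩
    -- The derivative in the `i`-th coordinate direction of `t` is the frame vector `a u i`.
    have := fderiv_sweep_snd ha t (Pi.single i 1)
    have h2 : sweep a (u, Pi.single i 1) = a u i := by
      simp [sweep, Pi.single_apply]
    rw [← h2, ← this]
    exact fderiv_mem_homogeneousTangent _ _ _
  have hker : LinearMap.ker (Ψ.domRestrict N) =
      (polar (homogeneousTangent 𝓘(ℝ, P) Z u)).comap N.subtype := by
    ext y
    rw [LinearMap.mem_ker, Submodule.mem_comap, mem_polar_homogeneousTangent]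
    -- The kernel of `Ψ` alone omits the condition `(Z, y) = 0`, which holds on the whole tangent
    -- subspace.
    have h0 := mem_polar_span_singleton.1 (homogeneousTangent_sweep_le hZ ha hs t y.2)
    refine ⟨fun h => ⟨h0, fun v => ?_⟩, fun h => LinearMap.ext fun v => h.2 v⟩
    exact congrArg (fun l : Module.Dual ℝ P => l v) h
  rw [← (Ψ.domRestrict N).finrank_range_add_finrank_ker, LinearMap.range_domRestrict, hmap, hker,
    (Submodule.comapSubtypeEquivOfLe hle).finrank_eq]

variable [FiniteDimensional ℝ P]

/-- The regular points are those at which the Hessian form is nondegenerate. -/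
theorem isRegularHypersurfacePoint_sweep_iff (hP : 1 ≤ finrank ℝ P)
    (hT : finrank ℝ (homogeneousTangent 𝓘(ℝ, P) Z u) = finrank ℝ P + 1)
    (t : Fin k → ℝ) :
    IsRegularHypersurfacePoint 𝓘(ℝ, P × (Fin k → ℝ)) (sweep a) (u, t) ↔
      (polarHessian Z u (sweep a (u, t))).Nondegenerate := by
  have h1 := finrank_homogeneousTangent_sweep hZ ha hs t
  have h2 := (polarHessian Z u (sweep a (u, t))).finrank_range_add_finrank_ker
  have h3 : finrank ℝ P + 1 ≤ n + 2 := by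
    rw [← hT, ← finrank_polyspherical]
    exact Submodule.finrank_le _
  rw [finrank_polar, hT] at h1
  rw [IsRegularHypersurfacePoint, finrank_polyspherical,
    LinearMap.BilinForm.nondegenerate_iff_ker_eq_bot, ← Submodule.finrank_eq_zero (R := ℝ)]
  refine ⟨fun h => by omega, fun h => ⟨fun h0 => ?_, by omega⟩⟩
  -- A zero vector would make the Hessian form vanish, and the zero form is degenerate because `dim
  -- P ≥ 1`.
  have : LinearMap.ker (polarHessian Z u (sweep a (u, t))) = ⊤ := by
    rw [LinearMap.ker_eq_top]
    ext v v'
    simp [h0]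
  rw [this, finrank_top] at h
  omega

end Sweep

/-! ### Nondegenerate members of families of bilinear forms -/

section LinearFamilies

variable {P : Type*} [AddCommGroup P] [Module ℝ P] [FiniteDimensional ℝ P]

theorem eventually_nondegenerate {S : Type*} [TopologicalSpace S]
    {Φ : S → LinearMap.BilinForm ℝ P} {s : S} (hΦ : ∀ v v', ContinuousAt (fun s => Φ s v v') s)
    (hs : (Φ s).Nondegenerate) : ∀ᶠ s in 𝓝 s, (Φ s).Nondegenerate := by
  let b := Module.finBasis ℝ P
  simp only [LinearMap.BilinForm.nondegenerate_iff_det_ne_zero b] at hs ⊢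
  have h1 : ContinuousAt (fun s => LinearMap.BilinForm.toMatrix b (Φ s)) s := by
    refine continuousAt_pi.2 fun i => continuousAt_pi.2 fun j => ?_
    simpa using hΦ (b i) (b j)
  have h2 : ContinuousAt (fun s => (LinearMap.BilinForm.toMatrix b (Φ s)).det) s :=
    (Continuous.matrix_det continuous_id).continuousAt.comp h1
  exact h2.eventually_ne hs

/-- In a linear family of bilinear forms with a nondegenerate member almost all members are
nondegenerate. -/
theorem dense_setOf_nondegenerate {S : Type*} [NormedAddCommGroup S] [NormedSpace ℝ S]
    [FiniteDimensional ℝ S] (Φ : S →ₗ[ℝ] LinearMap.BilinForm ℝ P) {s₀ : S}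
    (h : (Φ s₀).Nondegenerate) : Dense {s | (Φ s).Nondegenerate} := by
  let b := Module.finBasis ℝ P
  simp only [LinearMap.BilinForm.nondegenerate_iff_det_ne_zero b] at h ⊢
  have hentry : ∀ i j, AnalyticOnNhd ℝ (fun s => LinearMap.BilinForm.toMatrix b (Φ s) i j)
      Set.univ := fun i j => by
    let L : S →ₗ[ℝ] ℝ := (LinearMap.applyₗ (b j)).comp ((LinearMap.applyₗ (b i)).comp Φ)
    have := (LinearMap.toContinuousLinearMap L).analyticOnNhd Set.univ
    refine this.congr isOpen_univ fun s _ => ?_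
    simp [L]
  have han : AnalyticOnNhd ℝ (fun s => (LinearMap.BilinForm.toMatrix b (Φ s)).det) Set.univ := by
    simp only [Matrix.det_apply']
    exact Finset.analyticOnNhd_fun_sum _ fun σ _ => analyticOnNhd_const.mul
      (Finset.analyticOnNhd_fun_prod _ fun i _ => hentry _ _)
  by_contra hd
  obtain ⟨s₁, hs₁⟩ := not_forall.1 hd
  rw [mem_closure_iff_frequently, not_frequently] at hs₁
  -- If nondegenerate members were not dense, the determinant would vanish on an open set, hence
  -- everywhere by the identity theorem, including at `s₀`.
  refine h (han.eqOn_zero_of_preconnected_of_eventuallyEq_zero isPreconnected_univ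
    (Set.mem_univ s₁) ?_ (Set.mem_univ s₀))
  filter_upwards [hs₁] with s hs
  simpa using hs

end LinearFamilies

/-! ### Immersions, submersions and their fibres -/

section FirstOrder

variable {E : Type*} [NormedAddCommGroup E] [NormedSpace ℝ E]
  {B : Type*} [NormedAddCommGroup B] [NormedSpace ℝ B] [FiniteDimensional ℝ B]

/-- The tangent subspace is the range of `(c, v) ↦ c • f u + df v`, so its dimension is maximal
exactly when this map is injective. -/
theorem finrank_homogeneousTangent_eq_iff {f : B → E} {u : B} :
    finrank ℝ (homogeneousTangent 𝓘(ℝ, B) f u) = finrank ℝ B + 1 ↔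
      ∀ (c : ℝ) (v : B), c • f u + fderiv ℝ f u v = 0 → c = 0 ∧ v = 0 := by
  let L : ℝ × B →ₗ[ℝ] E :=
    (LinearMap.toSpanSingleton ℝ E (f u)).coprod (fderiv ℝ f u : B →ₗ[ℝ] E)
  have hL : ∀ c v, L (c, v) = c • f u + fderiv ℝ f u v := fun c v => rfl
  have hr : LinearMap.range L = homogeneousTangent 𝓘(ℝ, B) f u := by
    apply le_antisymm
    · rintro _ ⟨⟨c, v⟩, rfl⟩
      rw [hL]
      exact Submodule.add_mem _ (Submodule.smul_mem _ _ (mem_homogeneousTangent_self f u))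
        (fderiv_mem_homogeneousTangent f u v)
    · refine homogeneousTangent_vectorSpace_le_iff.2 ⟨⟨(1, 0), ?_⟩, fun v => ⟨(0, v), ?_⟩⟩ <;>
        simp [hL]
  have h1 := L.finrank_range_add_finrank_ker
  rw [hr, Module.finrank_prod, Module.finrank_self] at h1
  have h2 : finrank ℝ (homogeneousTangent 𝓘(ℝ, B) f u) = finrank ℝ B + 1 ↔
      finrank ℝ (LinearMap.ker L) = 0 := by omega
  rw [h2, Submodule.finrank_eq_zero, LinearMap.ker_eq_bot']
  simp [← hL]

/-- An immersion is not constant on the fibres of a submersion onto a space of lower dimension. -/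
theorem not_eventually_const_on_fibre {P : Type*} [NormedAddCommGroup P] [NormedSpace ℝ P]
    [FiniteDimensional ℝ P] {h : B → P} {X : B → E} {q : B} (hh : ContDiffAt ℝ ∞ h q)
    (hX : DifferentiableAt ℝ X q) (hs : Function.Surjective (fderiv ℝ h q))
    (hi : Function.Injective (fderiv ℝ X q)) (hd : finrank ℝ P < finrank ℝ B) :
    ¬ ∀ᶠ q' in 𝓝 q, h q' = h q → X q' = X q := by
  intro hc
  have : CompleteSpace B := FiniteDimensional.complete ℝ B
  have hst : HasStrictFDerivAt h (fderiv ℝ h q) q := hh.hasStrictFDerivAt (by simp)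
  -- The implicit function `γ` parametrizes the fibre of `h` through `q` by the kernel of `dh`, and
  -- its derivative at `0` is the inclusion. If `X` is constant on the fibre, then `dX` kills this
  -- kernel, so the kernel is trivial, against the dimensions.
  have hr : (fderiv ℝ h q).range = ⊤ := LinearMap.range_eq_top.2 hs
  set γ := hst.implicitFunction h (fderiv ℝ h q) hr (h q) with hγ
  have hγ0 : γ 0 = q := hst.implicitFunction_apply_image hr
  have hγd : HasFDerivAt γ (fderiv ℝ h q).ker.subtypeL 0 :=
    (hst.to_implicitFunction hr).hasFDerivAt
  have hfib : ∀ᶠ y in 𝓝 (0 : (fderiv ℝ h q).ker), h (γ y) = h q := by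
    have hcont : ContinuousAt (fun y : (fderiv ℝ h q).ker => (h q, y)) 0 := by fun_prop
    exact hcont.eventually (hst.map_implicitFunction_eq hr)
  have hγc : Tendsto γ (𝓝 0) (𝓝 q) := by
    have := hγd.continuousAt.tendsto
    rwa [hγ0] at this
  have hconst : (fun y => X (γ y)) =ᶠ[𝓝 0] fun _ => X q := by
    filter_upwards [hγc.eventually hc, hfib] with y h1 h2
    exact h1 h2
  have hXd : HasFDerivAt X (fderiv ℝ X q) (γ 0) := by rw [hγ0]; exact hX.hasFDerivAt
  have h1 := hXd.comp (0 : (fderiv ℝ h q).ker) hγd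
  have h2 : HasFDerivAt (X ∘ γ) (0 : (fderiv ℝ h q).ker →L[ℝ] E) 0 :=
    (hasFDerivAt_const (X q) 0).congr_of_eventuallyEq hconst
  have h3 := h1.unique h2
  have hker : (fderiv ℝ h q).ker = ⊥ := by
    refine (Submodule.eq_bot_iff _).2 fun v hv => hi ?_
    have := congrArg (fun L : (fderiv ℝ h q).ker →L[ℝ] E => L ⟨v, hv⟩) h3
    simpa using this
  have h4 := LinearMap.finrank_range_add_finrank_ker (fderiv ℝ h q : B →ₗ[ℝ] P)
  rw [hker, hr, finrank_bot, finrank_top] at h4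
  omega

end FirstOrder

/-! ### The point of contact has a nondegenerate Hessian form -/

section Contact

variable {n : ℕ} {P : Type*} [NormedAddCommGroup P] [NormedSpace ℝ P]
  {Q : Type*} [NormedAddCommGroup Q] [NormedSpace ℝ Q]
  {Z : P → Polyspherical n} {h : Q → P} {q : Q}

/-- The points at which the envelope touches a hypersphere lie in the polar of the tangent subspace
of the family. -/
theorem mem_polar_homogeneousTangent_of_touches {X : Q → Polyspherical n}
    (hZ : DifferentiableAt ℝ Z (h q)) (hh : DifferentiableAt ℝ h q) (hX : DifferentiableAt ℝ X q)
    (h0 : ∀ᶠ q in 𝓝 q, darbouxForm n (Z (h q)) (X q) = 0)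
    (h1 : ∀ v, darbouxForm n (Z (h q)) (fderiv ℝ X q v) = 0)
    (hs : Function.Surjective (fderiv ℝ h q)) :
    X q ∈ polar (homogeneousTangent 𝓘(ℝ, P) Z (h q)) := by
  refine mem_polar_homogeneousTangent.2 ⟨h0.self_of_nhds, fun v => ?_⟩
  obtain ⟨w, rfl⟩ := hs v
  have := darbouxForm_hasFDerivAt (hZ.hasFDerivAt.comp q hh.hasFDerivAt) hX.hasFDerivAt h0 w
  have h2 : darbouxForm n ((Z ∘ h) q) (fderiv ℝ X q w) = 0 := h1 w
  -- Tangency removes the term `(Z, dX w)` of the product rule. What remains is the derivative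
  -- condition of the characteristic, in the direction `dh w`.
  rwa [h2, zero_add] at this

variable [FiniteDimensional ℝ P] [FiniteDimensional ℝ Q]

/-- The points of contact are regular points of the hypersurface swept out by the polars. -/
theorem polarHessian_nondegenerate_of_contact {x : Q → ConformalSpace n}
    (hZ : ContDiffAt ℝ ∞ Z (h q)) (hh : ContDiffAt ℝ ∞ h q)
    (hX : DifferentiableAt ℝ (fun q => darbouxPoint (x q)) q)
    (hs : Function.Surjective (fderiv ℝ h q))
    (hi : Function.Injective (fderiv ℝ (fun q => darbouxPoint (x q)) q))
    (hPQ : finrank ℝ P < finrank ℝ Q) (hQ : finrank ℝ Q + 1 = n)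
    (hT : finrank ℝ (homogeneousTangent 𝓘(ℝ, P) Z (h q)) = finrank ℝ P + 1)
    (hout : 0 < darbouxForm n (Z (h q)) (Z (h q)))
    (hp : ∀ᶠ q in 𝓝 q, darbouxPoint (x q) ∈ polar (homogeneousTangent 𝓘(ℝ, P) Z (h q))) :
    (polarHessian Z (h q) (darbouxPoint (x q))).Nondegenerate := by
  set X : Q → Polyspherical n := fun q => darbouxPoint (x q) with hXdef
  have hnull : ∀ q, darbouxForm n (X q) (X q) = 0 := fun q => (darbouxForm_darbouxPoint _ _).2 rfl
  have hXX : ∀ v, darbouxForm n (X q) (fderiv ℝ X q v) = 0 := fun v => by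
    have := darbouxForm_hasFDerivAt hX.hasFDerivAt hX.hasFDerivAt (Eventually.of_forall hnull) v
    rw [darbouxForm_comm (fderiv ℝ X q v)] at this
    linarith
  -- The last coordinate of `X` is constantly `1`, so `X q` is not in the image of `dX`. The tangent
  -- subspace thus has one dimension more than `Q`.
  have hX2 : ∀ v, (fderiv ℝ X q v).2 = 0 := fun v => by
    have h1 : HasFDerivAt (fun q => (X q).2) _ q := hasFDerivAt_snd.comp q hX.hasFDerivAt
    have h2 := h1.unique (hasFDerivAt_const (1 : ℝ) q)
    exact congrArg (fun L : Q →L[ℝ] ℝ => L v) h2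
  have hR : finrank ℝ (homogeneousTangent 𝓘(ℝ, Q) X q) = finrank ℝ Q + 1 := by
    refine finrank_homogeneousTangent_eq_iff.2 fun c v hcv => ?_
    have h1 := congrArg Prod.snd hcv
    rw [Prod.snd_add, Prod.smul_snd, hX2] at h1
    have hc : c = 0 := by simpa [hXdef, darbouxPoint] using h1
    refine ⟨hc, hi ?_⟩
    simpa [hc] using hcv
  have hZX : darbouxForm n (X q) (Z (h q)) = 0 := by
    rw [darbouxForm_comm]
    exact (mem_polar_homogeneousTangent.1 hp.self_of_nhds).1
  -- The tangent subspace of `X` has dimension `n` in a space of dimension `n + 2`, so its polar is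
  -- two-dimensional. `X` and `Z` lie in it and are independent, because `(Z, Z) > 0` while `(Z, X)
  -- = 0`.
  have hspan : Submodule.span ℝ {X q, Z (h q)} = polar (homogeneousTangent 𝓘(ℝ, Q) X q) := by
    apply Submodule.eq_of_le_of_finrank_eq
    · rw [Submodule.span_le]
      rintro y (rfl | rfl)
      · refine mem_polar_homogeneousTangent.2 ⟨hnull q, fun v => ?_⟩
        rw [darbouxForm_comm, hXX]
      · refine mem_polar_homogeneousTangent.2 ⟨hZX, fun v => ?_⟩
        rw [darbouxForm_comm]
        exact darbouxForm_fderiv_eq_zero hZ (hh.differentiableAt (by simp)) hX hp v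
    · have hli : LinearIndependent ℝ ![X q, Z (h q)] := by
        refine LinearIndependent.pair_iff.2 fun s t hst => ?_
        have h1 := congrArg (fun y => darbouxForm n (Z (h q)) y) hst
        simp only [map_add, map_smul, smul_eq_mul, map_zero] at h1
        rw [darbouxForm_comm, hZX, mul_zero, zero_add] at h1
        have ht : t = 0 := (mul_eq_zero.1 h1).resolve_right hout.ne'
        have h2 := congrArg Prod.snd hst
        rw [ht] at h2
        exact ⟨by simpa [hXdef, darbouxPoint] using h2, ht⟩
      have := finrank_span_eq_card hli
      rw [show Set.range ![X q, Z (h q)] = {X q, Z (h q)} by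
        simp [Matrix.range_cons, Set.pair_comm], Fintype.card_fin] at this
      rw [finrank_polar, hR, hQ, this]
      omega
  have hsymm := hZ.isSymmSndFDerivAt (by
    rw [minSmoothness_of_isRCLikeNormedField]
    exact WithTop.coe_le_coe.2 (le_top : (2 : ℕ∞) ≤ ⊤))
  rw [LinearMap.BilinForm.nondegenerate_iff_ker_eq_bot, LinearMap.ker_eq_bot']
  intro u hu
  -- Symmetry of the second derivative moves the kernel vector into the second slot, where
  -- `darbouxForm_fderiv_fderiv` needs it.
  have hu' : ∀ v, polarHessian Z (h q) (X q) v u = 0 := fun v => by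
    rw [polarHessian_apply, hsymm.eq, ← polarHessian_apply, hu]
    rfl
  have hmem : fderiv ℝ Z (h q) u ∈ Submodule.span ℝ {X q, Z (h q)} := by
    rw [hspan]
    refine mem_polar_homogeneousTangent.2 ⟨?_, fun v => ?_⟩
    · rw [darbouxForm_comm]
      exact (mem_polar_homogeneousTangent.1 hp.self_of_nhds).2 u
    · rw [darbouxForm_comm, darbouxForm_fderiv_fderiv hZ (hh.differentiableAt (by simp)) hX hp,
        hu', neg_zero]
  obtain ⟨c, d, hcd⟩ := Submodule.mem_span_pair.1 hmem
  have hc : c = 0 := by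
    by_contra hc
    have hXT : X q ∈ homogeneousTangent 𝓘(ℝ, P) Z (h q) := by
      rw [← Submodule.smul_mem_iff _ hc, eq_sub_of_add_eq hcd]
      exact Submodule.sub_mem _ (fderiv_mem_homogeneousTangent Z _ u)
        (Submodule.smul_mem _ _ (mem_homogeneousTangent_self Z _))
    -- Nearby points with the same parameter lie in the polar of the same `T`, which contains `X q`.
    -- They are therefore conjugate to `X q`, hence equal to it.
    refine not_eventually_const_on_fibre hh hX hs hi hPQ ?_
    filter_upwards [hp] with q' hq' heq
    rw [heq] at hq'
    exact congrArg darbouxPoint ((darbouxForm_darbouxPoint _ _).1 (mem_polar.1 hq' _ hXT)).symm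
  refine (finrank_homogeneousTangent_eq_iff.1 hT (-d) u ?_).2
  rw [← hcd, hc]
  simp

end Contact

/-! ### Smooth frames of the generators -/

section Frame

variable {n : ℕ} {P : Type*} [NormedAddCommGroup P] [NormedSpace ℝ P] [FiniteDimensional ℝ P]

/-- The polars of the tangent subspaces have smooth local frames. -/
theorem exists_isSmoothFrameOn_polar {Z : P → Polyspherical n} {U : Set P} (hU : IsOpen U)
    (hZ : ContDiffOn ℝ ∞ Z U) {k : ℕ} (hk : finrank ℝ P + k = n + 1)
    (hT : ∀ u ∈ U, finrank ℝ (homogeneousTangent 𝓘(ℝ, P) Z u) = finrank ℝ P + 1)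
    {u₀ : P} (hu₀ : u₀ ∈ U) :
    ∃ U' ⊆ U, u₀ ∈ U' ∧ ∃ a : P → Fin k → Polyspherical n, IsSmoothFrameOn 𝓘(ℝ, P)
      (fun u => polar (homogeneousTangent 𝓘(ℝ, P) Z u)) U' a := by
  have hfin : ∀ u ∈ U, finrank ℝ (polar (homogeneousTangent 𝓘(ℝ, P) Z u)) = k := fun u hu => by
    rw [finrank_polar, hT u hu]
    omega
  set α := polar (homogeneousTangent 𝓘(ℝ, P) Z u₀) with hα
  obtain ⟨pr, hpr⟩ := α.subtype.exists_leftInverse_of_injective α.ker_subtype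
  let Pr : Polyspherical n →L[ℝ] α := LinearMap.toContinuousLinearMap pr
  have hPr : ∀ y : α, Pr y = y := fun y => congrArg (fun l : α →ₗ[ℝ] α => l y) hpr
  -- The equations of the polar are bordered by a fixed projection onto the plane at `u₀`, which
  -- makes `Φ u₀` bijective. Where `Φ u` is invertible, its inverse carries the vectors `(0, b)`,
  -- with `b` in a basis of `α`, to a basis of the polar at `u`.
  let Φ : P → Polyspherical n →L[ℝ] (ℝ × (P →L[ℝ] ℝ)) × α := fun u =>
    ((darbouxCLM n (Z u)).prod (((darbouxCLM n).comp (fderiv ℝ Z u)).flip)).prod Pr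
  have hΦ : ∀ u y, Φ u y =
      ((darbouxForm n (Z u) y, ((darbouxCLM n).comp (fderiv ℝ Z u)).flip y), Pr y) :=
    fun u y => rfl
  have hΦmem : ∀ u y, (Φ u y).1 = 0 ↔ y ∈ polar (homogeneousTangent 𝓘(ℝ, P) Z u) := fun u y => by
    rw [hΦ, mem_polar_homogeneousTangent, Prod.mk_eq_zero, ContinuousLinearMap.ext_iff]
    rfl
  have hdim : finrank ℝ (Polyspherical n) = finrank ℝ ((ℝ × (P →L[ℝ] ℝ)) × α) := by
    have h1 : finrank ℝ (P →L[ℝ] ℝ) = finrank ℝ P :=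
      (LinearMap.toContinuousLinearMap (E := P) (F' := ℝ) (𝕜 := ℝ)).finrank_eq.symm.trans
        Subspace.dual_finrank_eq
    rw [finrank_polyspherical, Module.finrank_prod, Module.finrank_prod, hfin u₀ hu₀, h1,
      Module.finrank_self]
    omega
  have hinj : LinearMap.ker (Φ u₀ : Polyspherical n →ₗ[ℝ] (ℝ × (P →L[ℝ] ℝ)) × α) = ⊥ := by
    refine LinearMap.ker_eq_bot'.2 fun y hy => ?_
    have h1 : y ∈ α := (hΦmem u₀ y).1 (congrArg Prod.fst hy)
    have h2 : Pr y = 0 := congrArg Prod.snd hy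
    have h3 := hPr ⟨y, h1⟩
    rw [h2] at h3
    exact congrArg Subtype.val h3.symm
  let e₀ : Polyspherical n ≃L[ℝ] (ℝ × (P →L[ℝ] ℝ)) × α :=
    (LinearEquiv.ofInjectiveOfFinrankEq (Φ u₀ : Polyspherical n →ₗ[ℝ] _)
      (LinearMap.ker_eq_bot.1 hinj) hdim).toContinuousLinearEquiv
  have he₀ : Φ u₀ = e₀ := ContinuousLinearMap.ext fun y => rfl
  have hΦs : ContDiffOn ℝ ∞ Φ U := by
    refine contDiffOn_clm_apply.2 fun y => ContDiffOn.prodMk (ContDiffOn.prodMk ?_ ?_)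
      contDiffOn_const
    · exact ((darbouxCLM n).flip y).contDiff.comp_contDiffOn hZ
    · refine contDiffOn_clm_apply.2 fun v => ((darbouxCLM n).flip y).contDiff.comp_contDiffOn
        ((hZ.fderiv_of_isOpen hU le_rfl).clm_apply contDiffOn_const)
  let a : P → Fin k → Polyspherical n := fun u i =>
    (Φ u).inverse (0, Module.finBasisOfFinrankEq ℝ α (hfin u₀ hu₀) i)
  let R := Set.range ((↑) : (Polyspherical n ≃L[ℝ] (ℝ × (P →L[ℝ] ℝ)) × α) →
    (Polyspherical n →L[ℝ] (ℝ × (P →L[ℝ] ℝ)) × α))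
  refine ⟨U ∩ Φ ⁻¹' R, Set.inter_subset_left, ⟨hu₀, e₀, he₀.symm⟩, a, ?_, fun i => ?_, ?_, ?_⟩
  · exact hΦs.continuousOn.isOpen_inter_preimage hU (ContinuousLinearEquiv.isOpen)
  · refine contMDiffOn_iff_contDiffOn.2 fun u ⟨hu, e, he⟩ => ContDiffAt.contDiffWithinAt ?_
    have h1 : ContDiffAt ℝ ∞ Φ u := hΦs.contDiffAt (hU.mem_nhds hu)
    -- The frame inherits smoothness from operator inversion, which is smooth at invertible
    -- operators.
    have h2 : ContDiffAt ℝ ∞ ContinuousLinearMap.inverse (Φ u) := by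
      rw [← he]
      exact contDiffAt_map_inverse e
    exact (h2.comp u h1).clm_apply contDiffAt_const
  all_goals
    rintro u ⟨hu, e, he⟩
    have hae : ∀ i, a u i = e.symm (0, Module.finBasisOfFinrankEq ℝ α (hfin u₀ hu₀) i) := by
      intro i
      simp only [a, ← he, ContinuousLinearMap.inverse_equiv]
      rfl
    have hli : LinearIndependent ℝ (a u) := by
      have h1 := (Module.finBasisOfFinrankEq ℝ α (hfin u₀ hu₀)).linearIndependent.map'
        (e.symm.toLinearMap.comp (LinearMap.inr ℝ (ℝ × (P →L[ℝ] ℝ)) α)) (by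
          refine LinearMap.ker_eq_bot'.2 fun y hy => ?_
          have := e.symm.injective (hy.trans (map_zero e.symm).symm)
          exact congrArg Prod.snd this)
      rw [funext hae]
      exact h1
  · exact hli
  · apply Submodule.eq_of_le_of_finrank_eq
    · rw [Submodule.span_le]
      rintro _ ⟨i, rfl⟩
      refine (hΦmem u _).1 ?_
      rw [← he, hae]
      simp
    · rw [finrank_span_eq_card hli, Fintype.card_fin, hfin u hu]

end Frame

/-! ### Regular points and the Gauss map on the manifold -/

section LocalCoordinates

variable {n r k : ℕ} {W : Type*} [TopologicalSpace W] [ChartedSpace (EuclideanSpace ℝ (Fin r)) W]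
  {z : W → ℙ ℝ (Polyspherical n)}

/-- Changing the representative multiplies the value of the form by a square. -/
theorem IsOutside.darbouxForm_pos {O : Set W} {Z : W → Polyspherical n}
    (hZ : IsSmoothLiftOn (𝓡 r) z O Z) {w : W} (hw : w ∈ O) (h : IsOutside (z w)) :
    0 < darbouxForm n (Z w) (Z w) := by
  have h1 : (z w).rep ∈ Submodule.span ℝ {Z w} := by
    rw [← hZ.submodule_eq hw, Projectivization.submodule_eq]
    exact Submodule.mem_span_singleton_self _
  obtain ⟨c, hc⟩ := Submodule.mem_span_singleton.1 h1
  rw [IsOutside, ← hc, map_smul, map_smul, LinearMap.smul_apply, smul_eq_mul, smul_eq_mul,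
    ← mul_assoc] at h
  exact pos_of_mul_pos_right h (mul_self_nonneg c)

theorem contMDiffOn_sweep {α : W → Submodule ℝ (Polyspherical n)} {O : Set W}
    {a : W → Fin k → Polyspherical n} (ha : IsSmoothFrameOn (𝓡 r) α O a) :
    ContMDiffOn ((𝓡 r).prod 𝓘(ℝ, Fin k → ℝ)) 𝓘(ℝ, Polyspherical n) ∞ (sweep a)
      (O ×ˢ Set.univ) := by
  unfold sweep
  refine contMDiffOn_finsetSum fun i _ => ?_
  have h1 : ContMDiffOn ((𝓡 r).prod 𝓘(ℝ, Fin k → ℝ)) 𝓘(ℝ, ℝ) ∞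
      (fun q : W × (Fin k → ℝ) => q.2 i) (O ×ˢ Set.univ) :=
    ((ContinuousLinearMap.proj (R := ℝ) (φ := fun _ : Fin k => ℝ)
      i).contDiff.contMDiff.comp contMDiff_snd).contMDiffOn
  have h2 : ContMDiffOn ((𝓡 r).prod 𝓘(ℝ, Fin k → ℝ)) 𝓘(ℝ, Polyspherical n) ∞
      (fun q : W × (Fin k → ℝ) => a q.1 i) (O ×ˢ Set.univ) :=
    (ha.smooth i).comp contMDiff_fst.contMDiffOn fun q hq => hq.1
  exact h1.smul h2

variable [IsManifold (𝓡 r) ∞ W]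

theorem projectiveTangent_extChartAt_symm {O : Set W} {Z : W → Polyspherical n}
    (hZ : IsSmoothLiftOn (𝓡 r) z O Z) (w : W) {u : EuclideanSpace ℝ (Fin r)}
    (hu : u ∈ (extChartAt (𝓡 r) w).target ∩ (extChartAt (𝓡 r) w).symm ⁻¹' O) :
    projectiveTangent (𝓡 r) z ((extChartAt (𝓡 r) w).symm u) =
      homogeneousTangent 𝓘(ℝ, EuclideanSpace ℝ (Fin r)) (Z ∘ (extChartAt (𝓡 r) w).symm) u := by
  rw [projectiveTangent_eq_homogeneousTangent hZ hu.2,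
    homogeneousTangent_extChartAt_symm w hu.1 (hZ.mdifferentiableAt hu.2)]

/-- The polars of the tangent subspaces of an immersed family have smooth local frames. -/
theorem exists_isSmoothFrameOn_generator (hz : IsSmoothProjective (𝓡 r) z)
    (hr : ∀ w, finrank ℝ (projectiveTangent (𝓡 r) z w) = r + 1) (hk : r + k = n + 1) (w : W) :
    ∃ (O : Set W) (a : W → Fin k → Polyspherical n),
      w ∈ O ∧ IsSmoothFrameOn (𝓡 r) (generator r z) O a := by
  obtain ⟨O, Z, hw, hZ⟩ := hz w
  have hT := fun u hu => projectiveTangent_extChartAt_symm hZ w (u := u) hu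
  obtain ⟨U, hUs, hwU, a, ha⟩ := exists_isSmoothFrameOn_polar
    (isOpen_extChartAt_target_inter w hZ.isOpen) (contMDiffOn_extChartAt_symm_comp hZ.smooth w)
    (k := k) (by rwa [finrank_euclideanSpace_fin])
    (fun u hu => by rw [← hT u hu, hr, finrank_euclideanSpace_fin])
    (extChartAt_mem_target_inter w hw (mem_extChartAt_source w))
  refine ⟨(extChartAt (𝓡 r) w).source ∩ extChartAt (𝓡 r) w ⁻¹' U, a ∘ extChartAt (𝓡 r) w,
    ⟨mem_extChartAt_source w, hwU⟩, ?_, fun i => ?_, fun p hp => ?_, fun p hp => ?_⟩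
  · exact (continuousOn_extChartAt w).isOpen_inter_preimage (isOpen_extChartAt_source w) ha.isOpen
  · exact (ha.smooth i).comp (((contMDiffOn_extChartAt (n := ∞)).mono (by
      rw [← extChartAt_source (𝓡 r)]; exact Set.inter_subset_left)))
      Set.inter_subset_right
  · exact ha.linearIndependent _ hp.2
  · rw [generator, characteristic_polarFamily hz]
    have h1 := ha.span _ hp.2
    rw [← hT _ (hUs hp.2), (extChartAt (𝓡 r) w).left_inv hp.1] at h1
    exact h1

theorem eventually_span_frame_extChartAt_symm (hz : IsSmoothProjective (𝓡 r) z) {O : Set W}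
    {a : W → Fin k → Polyspherical n} (ha : IsSmoothFrameOn (𝓡 r) (generator r z) O a)
    {O₁ : Set W} {Z : W → Polyspherical n} (hZ : IsSmoothLiftOn (𝓡 r) z O₁ Z) (w : W)
    {u : EuclideanSpace ℝ (Fin r)} (hu : u ∈ (extChartAt (𝓡 r) w).target ∩
      (extChartAt (𝓡 r) w).symm ⁻¹' (O ∩ O₁)) :
    ∀ᶠ p in 𝓝 u, Submodule.span ℝ (Set.range ((a ∘ (extChartAt (𝓡 r) w).symm) p)) =
      polar (homogeneousTangent 𝓘(ℝ, EuclideanSpace ℝ (Fin r))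
        (Z ∘ (extChartAt (𝓡 r) w).symm) p) := by
  filter_upwards [(isOpen_extChartAt_target_inter w (ha.isOpen.inter hZ.isOpen)).mem_nhds hu]
    with p hp
  rw [← projectiveTangent_extChartAt_symm hZ w ⟨hp.1, hp.2.2⟩, ← characteristic_polarFamily hz]
  exact ha.span _ hp.2.1

theorem homogeneousTangent_sweep_extChartAt_symm {α : W → Submodule ℝ (Polyspherical n)} {O : Set W}
    {a : W → Fin k → Polyspherical n} (ha : IsSmoothFrameOn (𝓡 r) α O a) (w : W)
    {u : EuclideanSpace ℝ (Fin r)} (hu : u ∈ (extChartAt (𝓡 r) w).target ∩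
      (extChartAt (𝓡 r) w).symm ⁻¹' O) (t : Fin k → ℝ) :
    homogeneousTangent ((𝓡 r).prod 𝓘(ℝ, Fin k → ℝ)) (sweep a) ((extChartAt (𝓡 r) w).symm u, t) =
      homogeneousTangent 𝓘(ℝ, EuclideanSpace ℝ (Fin r) × (Fin k → ℝ))
        (sweep (a ∘ (extChartAt (𝓡 r) w).symm)) (u, t) :=
  homogeneousTangent_prod_extChartAt_symm w hu.1 t <|
    ((contMDiffOn_sweep ha).contMDiffAt
      ((ha.isOpen.prod isOpen_univ).mem_nhds
        (show ((extChartAt (𝓡 r) w).symm u, t) ∈ O ×ˢ Set.univ from ⟨hu.2, trivial⟩))).mdifferentiableAt (by simp)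

theorem differentiableAt_frame_extChartAt_symm {α : W → Submodule ℝ (Polyspherical n)} {O : Set W}
    {a : W → Fin k → Polyspherical n} (ha : IsSmoothFrameOn (𝓡 r) α O a) (w : W)
    {u : EuclideanSpace ℝ (Fin r)} (hu : u ∈ (extChartAt (𝓡 r) w).target ∩
      (extChartAt (𝓡 r) w).symm ⁻¹' O) (i : Fin k) :
    DifferentiableAt ℝ (fun u => (a ∘ (extChartAt (𝓡 r) w).symm) u i) u :=
  (contDiffAt_comp_extChartAt_symm ha.isOpen (ha.smooth i) w hu).differentiableAt (by simp)

theorem isRegularHypersurfacePoint_extChartAt_symm_iff (hz : IsSmoothProjective (𝓡 r) z)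
    (hr : ∀ w, finrank ℝ (projectiveTangent (𝓡 r) z w) = r + 1) {O : Set W}
    {a : W → Fin k → Polyspherical n} (ha : IsSmoothFrameOn (𝓡 r) (generator r z) O a)
    {O₁ : Set W} {Z : W → Polyspherical n} (hZ : IsSmoothLiftOn (𝓡 r) z O₁ Z) (w : W)
    {u : EuclideanSpace ℝ (Fin r)} (hu : u ∈ (extChartAt (𝓡 r) w).target ∩
      (extChartAt (𝓡 r) w).symm ⁻¹' (O ∩ O₁)) (h1 : 1 ≤ r) (t : Fin k → ℝ) :
    IsRegularHypersurfacePoint ((𝓡 r).prod 𝓘(ℝ, Fin k → ℝ)) (sweep a)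
        ((extChartAt (𝓡 r) w).symm u, t) ↔
      (polarHessian (Z ∘ (extChartAt (𝓡 r) w).symm) u
        (sweep a ((extChartAt (𝓡 r) w).symm u, t))).Nondegenerate := by
  rw [IsRegularHypersurfacePoint, homogeneousTangent_sweep_extChartAt_symm ha w ⟨hu.1, hu.2.1⟩]
  exact isRegularHypersurfacePoint_sweep_iff (contDiffAt_comp_extChartAt_symm hZ.isOpen hZ.smooth w ⟨hu.1, hu.2.2⟩)
    (differentiableAt_frame_extChartAt_symm ha w ⟨hu.1, hu.2.1⟩)
    (eventually_span_frame_extChartAt_symm hz ha hZ w hu)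
    (by rwa [finrank_euclideanSpace_fin])
    (by rw [← projectiveTangent_extChartAt_symm hZ w ⟨hu.1, hu.2.2⟩, hr,
      finrank_euclideanSpace_fin]) t

variable (hz : IsSmoothProjective (𝓡 r) z)
  (hr : ∀ w, finrank ℝ (projectiveTangent (𝓡 r) z w) = r + 1) {O : Set W}
  {a : W → Fin k → Polyspherical n} (ha : IsSmoothFrameOn (𝓡 r) (generator r z) O a)
  {w : W} (hw : w ∈ O)
include hz ha hw

/-- At the regular points of the swept hypersurface the tangent hyperplane is the polar hyperplane. -/
theorem homogeneousTangent_sweep_eq_polarFamily {t : Fin k → ℝ}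
    (ht : IsRegularHypersurfacePoint ((𝓡 r).prod 𝓘(ℝ, Fin k → ℝ)) (sweep a) (w, t)) :
    homogeneousTangent ((𝓡 r).prod 𝓘(ℝ, Fin k → ℝ)) (sweep a) (w, t) = polarFamily z w := by
  obtain ⟨O₁, Z, hw₁, hZ⟩ := hz w
  have hu := extChartAt_mem_target_inter w (O := O ∩ O₁) ⟨hw, hw₁⟩
    (mem_extChartAt_source (I := 𝓡 r) w)
  have hinv := (extChartAt (𝓡 r) w).left_inv (mem_extChartAt_source w)
  apply Submodule.eq_of_le_of_finrank_eq
  · have h1 := homogeneousTangent_sweep_le (contDiffAt_comp_extChartAt_symm hZ.isOpen hZ.smooth w ⟨hu.1, hu.2.2⟩)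
      (differentiableAt_frame_extChartAt_symm ha w ⟨hu.1, hu.2.1⟩)
      (eventually_span_frame_extChartAt_symm hz ha hZ w hu) t
    rw [← homogeneousTangent_sweep_extChartAt_symm ha w ⟨hu.1, hu.2.1⟩, Function.comp_apply, hinv,
      ← hZ.submodule_eq hw₁] at h1
    exact h1
  · have h2 := ht.2
    rw [finrank_polyspherical] at h2
    rw [polarFamily, finrank_polar, Projectivization.finrank_submodule]
    omega

include hr

/-- In a chart the Hessian form depends continuously on the parameter and on `t`, and nondegeneracy
is an open condition. The Gauss map needs this, since its smoothness concerns a whole neighbourhood.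
-/
theorem eventually_isRegularHypersurfacePoint (h1 : 1 ≤ r) {t : Fin k → ℝ}
    (ht : IsRegularHypersurfacePoint ((𝓡 r).prod 𝓘(ℝ, Fin k → ℝ)) (sweep a) (w, t)) :
    ∀ᶠ q in 𝓝 (w, t),
      IsRegularHypersurfacePoint ((𝓡 r).prod 𝓘(ℝ, Fin k → ℝ)) (sweep a) q := by
  obtain ⟨O₁, Z, hw₁, hZ⟩ := hz w
  have hu := extChartAt_mem_target_inter w (O := O ∩ O₁) ⟨hw, hw₁⟩
    (mem_extChartAt_source (I := 𝓡 r) w)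
  have hinv := (extChartAt (𝓡 r) w).left_inv (mem_extChartAt_source w)
  have hreg := isRegularHypersurfacePoint_extChartAt_symm_iff hz hr ha hZ w hu h1 t
  rw [hinv] at hreg
  set φ := extChartAt (𝓡 r) w with hφ
  have hnd : ∀ᶠ q : EuclideanSpace ℝ (Fin r) × (Fin k → ℝ) in 𝓝 (φ w, t),
      (polarHessian (Z ∘ φ.symm) q.1 (sweep (a ∘ φ.symm) q)).Nondegenerate := by
    refine eventually_nondegenerate (fun v v' => ?_) ?_
    · have hc1 : ContinuousAt (sweep (a ∘ φ.symm)) (φ w, t) :=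
        (differentiableAt_sweep (differentiableAt_frame_extChartAt_symm ha w ⟨hu.1, hu.2.1⟩) t).continuousAt
      have hZ2 : ContDiffAt ℝ ∞ (fderiv ℝ (fderiv ℝ (Z ∘ φ.symm))) (φ w) :=
        ((contDiffAt_comp_extChartAt_symm hZ.isOpen hZ.smooth w ⟨hu.1, hu.2.2⟩).fderiv_right
          (m := ∞) le_rfl).fderiv_right (m := ∞) le_rfl
      have hc2 : ContinuousAt (fun q : EuclideanSpace ℝ (Fin r) × (Fin k → ℝ) =>
          fderiv ℝ (fderiv ℝ (Z ∘ φ.symm)) q.1) (φ w, t) :=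
        ContinuousAt.comp (g := fderiv ℝ (fderiv ℝ (Z ∘ φ.symm))) hZ2.continuousAt
          continuousAt_fst
      exact ((darbouxCLM n).continuous.continuousAt.comp hc1).clm_apply
        ((hc2.clm_apply continuousAt_const).clm_apply continuousAt_const)
    · have h2 := hreg.1 ht
      rw [sweep]
      simp only [Function.comp_apply, hinv]
      exact h2
  have hcont : ContinuousAt (fun q : W × (Fin k → ℝ) => (φ q.1, q.2)) (w, t) :=
    (ContinuousAt.comp (g := φ) (f := Prod.fst) (x := (w, t)) (continuousAt_extChartAt w)
      continuousAt_fst).prodMk continuousAt_snd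
  have hO : (φ.source ∩ (O ∩ O₁)) ×ˢ (Set.univ : Set (Fin k → ℝ)) ∈ 𝓝 (w, t) :=
    (((isOpen_extChartAt_source w).inter (ha.isOpen.inter hZ.isOpen)).prod isOpen_univ).mem_nhds
      ⟨⟨mem_extChartAt_source w, hw, hw₁⟩, trivial⟩
  filter_upwards [hcont.eventually hnd, hO] with q hq hqO
  have hinv' := φ.left_inv hqO.1.1
  have h3 := isRegularHypersurfacePoint_extChartAt_symm_iff hz hr ha hZ w
    (extChartAt_mem_target_inter w hqO.1.2 hqO.1.1) h1 q.2
  rw [← hφ, hinv'] at h3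
  refine h3.2 ?_
  rw [sweep] at hq
  simp only [Function.comp_apply, hinv'] at hq
  exact hq

/-- Near a regular point the Gauss map is `(w, t) ↦ (Z w, ·)`. It arises from `Z` by composition
with a submersion and an injective linear map, neither of which changes the dimension `r + 1` of the
tangent subspace. -/
theorem hasGaussRankAt_sweep (h1 : 1 ≤ r) {t : Fin k → ℝ}
    (ht : IsRegularHypersurfacePoint ((𝓡 r).prod 𝓘(ℝ, Fin k → ℝ)) (sweep a) (w, t)) :
    HasGaussRankAt ((𝓡 r).prod 𝓘(ℝ, Fin k → ℝ)) (sweep a) (w, t) r := by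
  obtain ⟨O₁, Z, hw₁, hZ⟩ := hz w
  have hO : (O ∩ O₁) ×ˢ (Set.univ : Set (Fin k → ℝ)) ∈ 𝓝 (w, t) :=
    ((ha.isOpen.inter hZ.isOpen).prod isOpen_univ).mem_nhds ⟨⟨hw, hw₁⟩, trivial⟩
  obtain ⟨D, hD, hDo, hwD⟩ := mem_nhds_iff.1
    (inter_mem hO (eventually_isRegularHypersurfacePoint hz hr ha hw h1 ht))
  have heq := hZ.isSmoothEquationOn_polarFamily
  refine ⟨D, (fun p => darbouxCLM n (Z p)) ∘ Prod.fst, hwD, ⟨hDo, ?_, ?_, ?_⟩, ?_⟩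
  · exact heq.smooth.comp contMDiff_fst.contMDiffOn fun q hq => (hD hq).1.1.2
  · exact fun q hq => heq.ne_zero q.1 (hD hq).1.1.2
  · intro q hq y
    rw [homogeneousTangent_sweep_eq_polarFamily hz ha (w := q.1) (t := q.2) (hD hq).1.1.1
      (hD hq).2]
    exact heq.mem_iff q.1 (hD hq).1.1.2 y
  · rw [homogeneousTangent_comp_of_surjective (I := 𝓡 r) (heq.mdifferentiableAt hw₁)
      mdifferentiableAt_fst (by
        rw [mfderiv_fst]
        exact fun v => ⟨(v, 0), rfl⟩),
      homogeneousTangent_clm_comp _ (hZ.mdifferentiableAt hw₁)]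
    refine (LinearEquiv.finrank_eq (Submodule.equivMapOfInjective
      (darbouxCLM n : Polyspherical n →ₗ[ℝ] (Polyspherical n →L[ℝ] ℝ)) darbouxCLM_injective
      (homogeneousTangent (𝓡 r) Z w))).symm.trans ?_
    rw [← projectiveTangent_eq_homogeneousTangent hZ hw₁, hr]

/-- If one point of a generator has a nondegenerate Hessian form, then almost all of its points are
regular. -/
theorem dense_setOf_isRegularHypersurfacePoint (h1 : 1 ≤ r)
    {O₁ : Set W} {Z : W → Polyspherical n} (hZ : IsSmoothLiftOn (𝓡 r) z O₁ Z) (hw₁ : w ∈ O₁)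
    {y : Polyspherical n} (hy : y ∈ generator r z w)
    (hnd : (polarHessian (Z ∘ (extChartAt (𝓡 r) w).symm) (extChartAt (𝓡 r) w w) y).Nondegenerate) :
    Dense {t : Fin k → ℝ |
      IsRegularHypersurfacePoint ((𝓡 r).prod 𝓘(ℝ, Fin k → ℝ)) (sweep a) (w, t)} := by
  have hu := extChartAt_mem_target_inter w (O := O ∩ O₁) ⟨hw, hw₁⟩
    (mem_extChartAt_source (I := 𝓡 r) w)
  have hinv := (extChartAt (𝓡 r) w).left_inv (mem_extChartAt_source w)
  have hreg := isRegularHypersurfacePoint_extChartAt_symm_iff hz hr ha hZ w hu h1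
  rw [hinv] at hreg
  simp only [hreg]
  -- On a fixed generator the Hessian form is linear in `t`, and `t₀` below is the coordinate vector
  -- of the point `y`.
  let Φ : (Fin k → ℝ) →ₗ[ℝ] LinearMap.BilinForm ℝ (EuclideanSpace ℝ (Fin r)) :=
    { toFun := fun t => polarHessian (Z ∘ (extChartAt (𝓡 r) w).symm) (extChartAt (𝓡 r) w w)
        (sweep a (w, t))
      map_add' := fun t s => by
        ext v v'
        simp [sweep, add_smul, Finset.sum_add_distrib]
      map_smul' := fun c t => by
        ext v v'
        simp [sweep, mul_smul, ← Finset.smul_sum, Finset.mul_sum] }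
  rw [← ha.span w hw] at hy
  obtain ⟨t₀, ht₀⟩ := (Submodule.mem_span_range_iff_exists_fun ℝ).1 hy
  refine dense_setOf_nondegenerate Φ (s₀ := t₀) ?_
  rwa [← ht₀] at hnd

end LocalCoordinates

/-! ### The canal hypersurface and its points of contact -/

section Canal

variable {n m r : ℕ}
  {V : Type*} [TopologicalSpace V] [ChartedSpace (EuclideanSpace ℝ (Fin (n - 1))) V]
  {W : Type*} [TopologicalSpace W] [ChartedSpace (EuclideanSpace ℝ (Fin r)) W]
  {x : V → ConformalSpace n} {z : W → ℙ ℝ (Polyspherical n)} {π : V → W}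

theorem contMDiff_coe_conformalSpace : ContMDiff (𝓡 n) 𝓘(ℝ, EuclideanSpace ℝ (Fin (n + 1))) ∞
    ((↑) : ConformalSpace n → EuclideanSpace ℝ (Fin (n + 1))) :=
  haveI : Fact (finrank ℝ (EuclideanSpace ℝ (Fin (n + 1))) = n + 1) := ⟨finrank_euclideanSpace_fin⟩
  contMDiff_coe_sphere

theorem injective_mvfderiv_coe_conformalSpace (s : ConformalSpace n) :
    Function.Injective (mvfderiv (𝓡 n)
      ((↑) : ConformalSpace n → EuclideanSpace ℝ (Fin (n + 1))) s) :=
  haveI : Fact (finrank ℝ (EuclideanSpace ℝ (Fin (n + 1))) = n + 1) := ⟨finrank_euclideanSpace_fin⟩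
  injective_mvfderiv_subtypeVal_sphere s

theorem contMDiff_darbouxPoint (hx : ContMDiff (𝓡 (n - 1)) (𝓡 n) ∞ x) :
    ContMDiff (𝓡 (n - 1)) 𝓘(ℝ, Polyspherical n) ∞ (fun p => darbouxPoint (x p)) :=
  (contMDiff_coe_conformalSpace.comp hx).prodMk_space contMDiff_const

theorem injective_mvfderiv_darbouxPoint (hx : ContMDiff (𝓡 (n - 1)) (𝓡 n) ∞ x) {p : V}
    (hi : Function.Injective (mfderiv (𝓡 (n - 1)) (𝓡 n) x p)) :
    Function.Injective (mvfderiv (𝓡 (n - 1)) (fun p => darbouxPoint (x p)) p) := by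
  refine (injective_iff_map_eq_zero _).2 fun v hv => ?_
  have hd := ((contMDiff_darbouxPoint hx) p).mdifferentiableAt (by simp)
  have h1 := mvfderiv_clm_comp (ContinuousLinearMap.fst ℝ (EuclideanSpace ℝ (Fin (n + 1))) ℝ) hd v
  rw [hv, map_zero] at h1
  have h2 := mvfderiv_comp_vector (I := 𝓡 n) (J := 𝓡 (n - 1))
    (f := ((↑) : ConformalSpace n → EuclideanSpace ℝ (Fin (n + 1)))) (g := x) (q := p)
    ((contMDiff_coe_conformalSpace (x p)).mdifferentiableAt (by simp))
    ((hx p).mdifferentiableAt (by simp)) v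
  have h3 := injective_mvfderiv_coe_conformalSpace (x p)
    ((h2.symm.trans h1).trans (map_zero _).symm)
  exact hi (h3.trans (map_zero _).symm)

variable [IsManifold (𝓡 (n - 1)) ∞ V] [IsManifold (𝓡 r) ∞ W]

/-- Each generator contains a point with a nondegenerate Hessian form: the point at which the canal
hypersurface touches the hypersphere. -/
theorem IsCanalHypersurface.exists_nondegenerate (h : IsCanalHypersurface n m r x z π) {w : W}
    {O : Set W} {Z : W → Polyspherical n} (hZ : IsSmoothLiftOn (𝓡 r) z O Z) (hw : w ∈ O) :
    ∃ y ∈ generator r z w, (polarHessian (Z ∘ (extChartAt (𝓡 r) w).symm)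
      (extChartAt (𝓡 r) w w) y).Nondegenerate := by
  obtain ⟨p, rfl⟩ := h.surjective w
  set φ := extChartAt (𝓡 r) (π p) with hφ
  set ψ := extChartAt (𝓡 (n - 1)) p with hψ
  have hS : IsOpen (π ⁻¹' (φ.source ∩ O)) :=
    ((isOpen_extChartAt_source (π p)).inter hZ.isOpen).preimage h.smooth_param.continuous
  -- On `D` the parameter `π` stays in the chart `φ` and in the domain of the lift `Z`, so `ρ` below
  -- is `π` in coordinates.
  set D := ψ.target ∩ ψ.symm ⁻¹' (π ⁻¹' (φ.source ∩ O)) with hDdef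
  have hD : IsOpen D := isOpen_extChartAt_target_inter p hS
  have hpD : ψ p ∈ D := extChartAt_mem_target_inter p
    (O := π ⁻¹' (φ.source ∩ O)) ⟨mem_extChartAt_source (π p), hw⟩ (mem_extChartAt_source p)
  have hψp : ψ.symm (ψ p) = p := ψ.left_inv (mem_extChartAt_source p)
  set ρ : EuclideanSpace ℝ (Fin (n - 1)) → EuclideanSpace ℝ (Fin r) := φ ∘ π ∘ ψ.symm with hρ
  set X : EuclideanSpace ℝ (Fin (n - 1)) → Polyspherical n :=
    fun q => darbouxPoint (x (ψ.symm q)) with hX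
  have hρp : ρ (ψ p) = φ (π p) := by simp [hρ, hψp]
  have hφρ : ∀ q ∈ D, φ.symm (ρ q) = π (ψ.symm q) := fun q hq => φ.left_inv hq.2.1
  have hρD : ∀ q ∈ D, ρ q ∈ φ.target ∩ φ.symm ⁻¹' O := fun q hq =>
    extChartAt_mem_target_inter (π p) hq.2.2 hq.2.1
  have hρs : ∀ q ∈ D, ContDiffAt ℝ ∞ ρ q := fun q hq => by
    refine ContDiffOn.contDiffAt (s := D) (contMDiffOn_iff_contDiffOn.1 ?_) (hD.mem_nhds hq)
    exact (contMDiffOn_extChartAt (n := ∞)).comp (h.smooth_param.comp_contMDiffOn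
      ((contMDiffOn_extChartAt_symm p).mono Set.inter_subset_left)) fun q hq => by
        rw [← extChartAt_source (𝓡 r)]; exact hq.2.1
  have hXs : ContDiffOn ℝ ∞ X D := contMDiffOn_iff_contDiffOn.1 <|
    (contMDiff_darbouxPoint h.smooth).comp_contMDiffOn
      ((contMDiffOn_extChartAt_symm p).mono Set.inter_subset_left)
  have hXd : ∀ q ∈ D, DifferentiableAt ℝ X q := fun q hq =>
    (hXs.contDiffAt (hD.mem_nhds hq)).differentiableAt (by simp)
  have hZs : ∀ q ∈ D, ContDiffAt ℝ ∞ (Z ∘ φ.symm) (ρ q) := fun q hq =>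
    contDiffAt_comp_extChartAt_symm hZ.isOpen hZ.smooth (π p) (hρD q hq)
  have hψd : ∀ q ∈ D, MDifferentiableAt 𝓘(ℝ, EuclideanSpace ℝ (Fin (n - 1))) (𝓡 (n - 1))
      ψ.symm q := fun q hq => mdifferentiableAt_extChartAt_symm p hq.1
  have hψb : ∀ q ∈ D, Function.Bijective
      (mfderiv 𝓘(ℝ, EuclideanSpace ℝ (Fin (n - 1))) (𝓡 (n - 1)) ψ.symm q) := fun q hq => by
    have := isInvertible_mfderivWithin_extChartAt_symm (I := 𝓡 (n - 1)) (x := p) hq.1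
    rw [ModelWithCorners.Boundaryless.range_eq_univ, mfderivWithin_univ] at this
    exact this.bijective
  have hXfd : ∀ q ∈ D, ∀ v, fderiv ℝ X q v = mvfderiv (𝓡 (n - 1)) (fun p => darbouxPoint (x p))
      (ψ.symm q) (mfderiv 𝓘(ℝ, EuclideanSpace ℝ (Fin (n - 1))) (𝓡 (n - 1)) ψ.symm q v) :=
    fun q hq v => by
      rw [← mvfderiv_eq_fderiv]
      exact mvfderiv_comp_vector
        ((contMDiff_darbouxPoint h.smooth _).mdifferentiableAt (by simp)) (hψd q hq) v
  have hρsurj : ∀ q ∈ D, Function.Surjective (fderiv ℝ ρ q) := fun q hq => by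
    have hφd : MDifferentiableAt (𝓡 r) 𝓘(ℝ, EuclideanSpace ℝ (Fin r)) φ (π (ψ.symm q)) :=
      (contMDiffAt_extChartAt' (n := ∞) (by
        rw [← extChartAt_source (𝓡 r)]; exact hq.2.1)).mdifferentiableAt (by simp)
    have hπd : MDifferentiableAt (𝓡 (n - 1)) (𝓡 r) π (ψ.symm q) :=
      (h.smooth_param _).mdifferentiableAt (by simp)
    rw [← mfderiv_eq_fderiv, hρ, mfderiv_comp (I' := 𝓡 r) q hφd (hπd.comp q (hψd q hq)),
      mfderiv_comp (I' := 𝓡 (n - 1)) q hπd (hψd q hq)]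
    exact (isInvertible_mfderiv_extChartAt hq.2.1).bijective.surjective.comp
      ((h.submersion _).comp (hψb q hq).surjective)
  have hZsub : ∀ q ∈ D, ∀ y, y ∈ polar (z (π (ψ.symm q))).submodule ↔
      darbouxForm n ((Z ∘ φ.symm) (ρ q)) y = 0 := fun q hq y => by
    rw [Function.comp_apply, hφρ q hq]
    exact hZ.mem_polarFamily hq.2.2
  -- Membership is needed on all of `D`, not just at `ψ p`, because the contact argument
  -- differentiates it and compares neighbouring points of a fibre.
  have hmem : ∀ q ∈ D, X q ∈ polar (homogeneousTangent 𝓘(ℝ, EuclideanSpace ℝ (Fin r))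
      (Z ∘ φ.symm) (ρ q)) := fun q hq => by
    refine mem_polar_homogeneousTangent_of_touches ((hZs q hq).differentiableAt (by simp))
      ((hρs q hq).differentiableAt (by simp)) (hXd q hq) ?_ (fun v => ?_) (hρsurj q hq)
    · filter_upwards [hD.mem_nhds hq] with q' hq'
      exact (hZsub q' hq' _).1 (h.touches (ψ.symm q')).1
    · rw [← hZsub q hq, hXfd q hq]
      exact (h.touches (ψ.symm q)).2 _
  have hTp := projectiveTangent_extChartAt_symm hZ (π p) (hρD _ hpD)
  rw [← hφ, hφρ _ hpD, hψp] at hTp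
  have hnd := polarHessian_nondegenerate_of_contact (Z := Z ∘ φ.symm) (h := ρ) (q := ψ p)
    (x := fun q => x (ψ.symm q)) (hZs _ hpD) (hρs _ hpD) (hXd _ hpD) (hρsurj _ hpD)
    (fun v v' hv => by
      rw [hXfd _ hpD, hXfd _ hpD] at hv
      exact (hψb _ hpD).injective
        (injective_mvfderiv_darbouxPoint h.smooth (h.immersion _) hv))
    -- Here `r < n - 1 = m + r`: the fibres of `π` have positive dimension because `m ≥ 1`.
    (by
      rw [finrank_euclideanSpace_fin, finrank_euclideanSpace_fin]
      have := h.dim; have := h.one_le_m; omega)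
    (by
      rw [finrank_euclideanSpace_fin]
      have := h.dim; omega)
    (by rw [← hTp, h.rank_family, finrank_euclideanSpace_fin])
    (by
      rw [Function.comp_apply, hφρ _ hpD, hψp]
      exact (h.outside (π p)).darbouxForm_pos hZ hw)
    (by filter_upwards [hD.mem_nhds hpD] with q hq using hmem q hq)
  rw [hρp] at hnd
  refine ⟨X (ψ p), ?_, hnd⟩
  rw [generator, characteristic_polarFamily h.smooth_family, hTp]
  exact hmem _ hpD

end Canal

theorem theorem5 (n m r : ℕ)
    {V : Type*} [TopologicalSpace V] [ChartedSpace (EuclideanSpace ℝ (Fin (n - 1))) V]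
    [IsManifold (𝓡 (n - 1)) ∞ V]
    {W : Type*} [TopologicalSpace W] [ChartedSpace (EuclideanSpace ℝ (Fin r)) W]
    [IsManifold (𝓡 r) ∞ W]
    (x : V → ConformalSpace n) (z : W → ℙ ℝ (Polyspherical n)) (π : V → W)
    (h : IsCanalHypersurface n m r x z π) :
    -- the generators are planes of dimension `m + 1`, polar to the tangent spaces of the family
    (∀ w, generator r z w = polar (projectiveTangent (𝓡 r) z w) ∧
      Module.finrank ℝ (generator r z w) = (m + 1) + 1) ∧
    -- the envelope of the polar hyperplanes is the union of these planes
    hyperplaneEnvelope (𝓡 r) (polarFamily z) =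
      {y | ∃ w, y.submodule ≤ polar (projectiveTangent (𝓡 r) z w)} ∧
    -- the planes depend smoothly on the `r` parameters
    (∀ w, ∃ (O : Set W) (a : W → Fin (m + 2) → Polyspherical n),
      w ∈ O ∧ IsSmoothFrameOn (𝓡 r) (generator r z) O a) ∧
    -- they sweep out a tangentially degenerate hypersurface of rank `r`
    ∀ (O : Set W) (a : W → Fin (m + 2) → Polyspherical n),
      IsSmoothFrameOn (𝓡 r) (generator r z) O a →
      IsTangentiallyDegenerateOn ((𝓡 r).prod 𝓘(ℝ, Fin (m + 2) → ℝ)) (sweep a)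
        (O ×ˢ Set.univ) r ∧
      -- almost all points of each generator are regular
      (∀ w ∈ O, Dense {t : Fin (m + 2) → ℝ |
        IsRegularHypersurfacePoint ((𝓡 r).prod 𝓘(ℝ, Fin (m + 2) → ℝ)) (sweep a) (w, t)}) ∧
      -- and there the tangent hyperplane is the polar hyperplane that belongs to the generator
      ∀ w ∈ O, ∀ t : Fin (m + 2) → ℝ,
        IsRegularHypersurfacePoint ((𝓡 r).prod 𝓘(ℝ, Fin (m + 2) → ℝ)) (sweep a) (w, t) →
          homogeneousTangent ((𝓡 r).prod 𝓘(ℝ, Fin (m + 2) → ℝ)) (sweep a) (w, t) =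
            polarFamily z w := by
  have hgen : ∀ w, generator r z w = polar (projectiveTangent (𝓡 r) z w) :=
    characteristic_polarFamily h.smooth_family
  have hn := h.dim
  have h1 := h.one_le_r
  refine ⟨fun w => ⟨hgen w, ?_⟩, ?_, fun w => ?_, fun O a ha => ?_⟩
  · rw [hgen, finrank_polar, h.rank_family]
    omega
  · ext y
    exact exists_congr fun w => by rw [characteristic_polarFamily h.smooth_family]
  · exact exists_isSmoothFrameOn_generator h.smooth_family h.rank_family (by omega) w
  · have hdense : ∀ w ∈ O, Dense {t : Fin (m + 2) → ℝ |
        IsRegularHypersurfacePoint ((𝓡 r).prod 𝓘(ℝ, Fin (m + 2) → ℝ)) (sweep a) (w, t)} := by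
      intro w hw
      obtain ⟨O₁, Z, hw₁, hZ⟩ := h.smooth_family w
      obtain ⟨y, hy, hnd⟩ := h.exists_nondegenerate hZ hw₁
      exact dense_setOf_isRegularHypersurfacePoint h.smooth_family h.rank_family ha hw h1 hZ hw₁
        hy hnd
    refine ⟨⟨ha.isOpen.prod isOpen_univ, contMDiffOn_sweep ha, ?_, ?_, ?_⟩, hdense, ?_⟩
    · rintro ⟨w, t⟩ ⟨hw, -⟩
      -- Density within the single generator through the point already gives density in the whole
      -- sweep.
      exact map_mem_closure (f := fun t => (w, t)) (by fun_prop) (hdense w hw t)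
        fun t ht => ⟨⟨hw, trivial⟩, ht⟩
    · rintro ⟨w, t⟩ ⟨hw, -⟩ ht
      exact hasGaussRankAt_sweep h.smooth_family h.rank_family ha hw h1 ht
    · have := h.one_le_m
      rw [finrank_polyspherical]
      omega
    · intro w hw t ht
      exact homogeneousTangent_sweep_eq_polarFamily h.smooth_family ha hw ht
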